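/- **Conventions.** For a C*-algebra $A$, $\mathfrak{sa}(A)$ is the space of its self-adjoint elements, $\mathscr S(A)$ its state space, $uA$ the smallest unital C*-algebra containing $A$ ($uA=A$ if $A$ is unital, $uA=A\oplus\mathbb C1$ otherwise), and for $a,b\in\mathfrak{sa}(A)$ put $a\circ b=\frac{ab+ba}{2}$, $\{a,b\}=\frac{ab-ba}{2i}$. Seminorms with a domain are extended by $\infty$ outside their domain. *Lipschitz pairs.* $(A,L)$ is a Lipschitz pair when $L$ is a seminorm on a dense subspace of $\mathfrak{sa}(uA)$ with $\{L=0\}=\mathbb R1$. It is Leibniz if $L(a\circ b)$ and $L(\{a,b\})$ are at most $\|a\|L(b)+L(a)\|b\|$ for all $a,b\in\mathfrak{sa}(A)$. Its Monge–Kantorovich extended metric is $\mathsf{mk}_L(\varphi,\psi)=\sup\{|\varphi(a)-\psi(a)|:a\in\mathfrak{sa}(A),L(a)\le1\}$ on $\mathscr S(A)$. A *Leibniz quantum compact metric space* $(A,L)$ is a Leibniz Lipschitz pair with $A$ unital, $L$ lower semicontinuous, and such that $\mathsf{mk}_L$ metrizes the weak* topology of $\mathscr S(A)$. *Topographies.*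 A topography $M$ on $A$ is a commutative C*-subalgebra containing an approximate unit of $A$; $M^\sigma$ is its Gel'fand spectrum. For $K\subseteq M^\sigma$ compact, $1_K$ is the indicator function of $K$, a projection in $M^{**}\subseteq A^{**}$; put $\mathscr S[A|K]=\{\varphi\in\mathscr S(A):\varphi(1_K)=1\}$ and $\mathrm{Loc}[A|K]=\{a\in\mathfrak{sa}(A):1_Ka1_K=a,\ L(a)<\infty\}$, and let $\mathrm{Loc}[A|\star]$ be the union of the sets $\mathrm{Loc}[A|K]$. On $M^\sigma$ let $\mathsf{mk}^\sigma_L(\chi,\chi')=\sup\{|\chi(m)-\chi'(m)|:m\in\mathfrak{sa}(M),L(m)\le 1\}$. A set $S\subseteq\mathscr S(A)$ is tame if $\lim_K\sup\{|\varphi(a-1_Ka1_K)|:\varphi\in S,\ a\in\mathfrak{sa}(A),\ L(a)\le1\}=0$, the limit being over the compact subsets $K$ of $M^\sigma$ directed by inclusion. $(A,L,M)$ is a *quantum locally compact metric space* if $(A,L)$ is a Lipschitz pair, $M$ is a topography on $A$, and $\mathsf{mk}_L$ metrizes the weak* topology of every tame subset of $\mathscr S(A)$. *Pointed proper quantum metric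 spaces.* These are $(A,L,M,\mu)$ where $(A,L,M)$ is a quantum locally compact metric space, $A$ is separable, $(A,L)$ is Leibniz, $L$ is lower semicontinuous, $\mathrm{Loc}[A|\star]$ is dense in $\mathfrak{sa}(A)\cap\mathrm{dom}(L)$, $\mathrm{Loc}[A|\star]\cap M$ is dense in $\mathfrak{sa}(M)$, $(M^\sigma,\mathsf{mk}^\sigma_L)$ is a proper metric space (finite distances, compact closed balls), and $\mu\in M^\sigma$. Write $\mathscr S[A|\mu,r]$ and $\mathrm{Loc}[A|\mu,r]$ when $K$ is the closed $\mathsf{mk}^\sigma_L$-ball of centre $\mu$ and radius $r$. *Passages.* Let $\mathbb A_i=(A_i,L_i,M_i,\mu_i)$, $i=1,2$, be two spaces with such data. A passage $\tau=(D,L_D,M_D,\pi_1,\pi_2)$ from $\mathbb A_1$ to $\mathbb A_2$ is a quantum locally compact metric space $(D,L_D,M_D)$ with $L_D$ lower semicontinuous and, for $i=1,2$, a *-morphism $\pi_i:D\to A_i$ (surjectivity is not assumed) with $\pi_i(M_D)\subseteq M_i$ that maps some approximate unit of $D$ lying in $M_D$ to an approximate unit of $A_i$. Put $\pi_i^*\varphi=\varphi\circ\pi_i$.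 *Admissibility.* Let $r>0$, $\varepsilon>0$ and $K\subseteq M_D^\sigma$ compact. $(\varepsilon,K)$ is $r$-left admissible if: * (i) $\pi_1^*\mathscr S[A_1|\mu_1,r]\subseteq\mathscr S[D|K]$; * (ii) every $\varphi\in\mathscr S[D|K]$ is at $\mathsf{mk}_{L_D}$-distance at most $\varepsilon$ from some element of $\pi_1^*\mathscr S[A_1|\mu_1,r+4\varepsilon]$; * (iii) for every $a\in\mathrm{Loc}[A_1|\mu_1,r]$ there is $d\in\mathrm{Loc}[D|K]$ with $\pi_1(d)=a$, $L_D(d)\le L_1(a)$ and $\pi_2(d)\in\mathrm{Loc}[A_2|\mu_2,r+4\varepsilon]$; * (iv) if moreover $a\in M_1$, then such a $d$ can be found with $\pi_2(d)\in M_2$; * (v) $L_2(\pi_2(d))\le L_D(d)$ for all $d\in\mathrm{Loc}[D|K]$. $(\varepsilon,K)$ is $r$-admissible if it is $r$-left admissible for $\tau$ and also for the inverse passage (indices $1$ and $2$ exchanged), if $|\mu_1(\pi_1(m))-\mu_2(\pi_2(m))|\le\varepsilon$ for all $m\in\mathfrak{sa}(M_D)$ with $L_D(m)\le1$, and if the two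 Leibniz inequalities hold for $L_D$ on $\mathrm{Loc}[D|K]$. $\mathrm{Adm}(\tau|r)$ is the set of all $\varepsilon>0$ for which there are compact sets $K_t\subseteq M_D^\sigma$, $t\in(0,r]$, nondecreasing in $t$, such that $(\varepsilon,K_t)$ is $t$-admissible for every $t\in(0,r]$. $\tau$ is an *$r$-tunnel* if $\mathrm{Adm}(\tau|r)\ne\emptyset$; its *$r$-extent* is $\inf\mathrm{Adm}(\tau|r)$. **Proposition.** Let $\mathbb A_1,\mathbb A_2$ be pointed proper quantum metric spaces, $r>0$, and let $\tau=(D,L_D,M_D,\pi_1,\pi_2)$ be an $r$-tunnel from $\mathbb A_1$ to $\mathbb A_2$. Suppose that for some $j\in\{1,2\}$ the diameter of $(M_j^\sigma,\mathsf{mk}^\sigma_{L_j})$ is at most $r$. Then: 1. $(A_1,L_1)$, $(A_2,L_2)$ and $(D,L_D)$ are Leibniz quantum compact metric spaces; 2. if $(\varepsilon,K)$ is $r$-admissible, then $K=M_D^\sigma$; 3. $L_j(a)=\inf\{L_D(d):d\in\mathfrak{sa}(D),\ \pi_j(d)=a\}$ for all $a\in\mathfrak{sa}(A_j)$; 4.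 $\pi_j$ is surjective. **Corollary.** Let $(A,L_A)$ and $(B,L_B)$ be Leibniz quantum compact metric spaces with $A,B\neq0$, regarded as $(A,L_A,\mathbb C1_A,\epsilon_A)$ and $(B,L_B,\mathbb C1_B,\epsilon_B)$ with $\epsilon(t1)=t$, and let $\tau=(D,L,M,\pi_A,\pi_B)$ be a passage between them. Call $(D,L,\pi_A,\pi_B)$ a *compact tunnel* if $(D,L)$ is a Leibniz quantum compact metric space, $\pi_A$ and $\pi_B$ are surjective, and $L_A$, $L_B$ are the quotients of $L$ by $\pi_A$, $\pi_B$ (as in 3). With Hausdorff distances taken for $\mathsf{mk}_L$ in $\mathscr S(D)$, its *extent* is $$\max\{\mathrm{Haus}(\mathscr S(D),\pi_A^*\mathscr S(A)),\ \mathrm{Haus}(\mathscr S(D),\pi_B^*\mathscr S(B))\}$$ and its *length* is $$\max\{\mathrm{Haus}(\pi_A^*\mathscr S(A),\pi_B^*\mathscr S(B)),\ \mathrm{Haus}(\mathscr S(D),\overline{\mathrm{co}}(\pi_A^*\mathscr S(A)\cup\pi_B^*\mathscr S(B)))\},$$ where $\overline{\mathrm{co}}$ is the weak* closed convex hull. Then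 the following are equivalent: 1. $\tau$ is an $r$-tunnel for some $r>0$; 2. $(D,L,\pi_A,\pi_B)$ is a compact tunnel of finite length; 3. $(D,L,\pi_A,\pi_B)$ is a compact tunnel of finite extent; 4. $\tau$ is an $r$-tunnel for all $r>0$. Moreover, if these hold, then for every $r>0$ the $r$-extent of $\tau$ is equal to the extent of $(D,L,\pi_A,\pi_B)$. -/

import Mathlib

namespace QuantumMetric

open WeakDual Topology Filter
open scoped ENNReal ComplexOrder

/-! ### The bidual of a C*-algebra as an algebra, and indicator projections -/

/-- The enveloping von Neumann algebra `A**`, as the Banach space bidual of `A`. -/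
abbrev Bidual (A : Type*) [NonUnitalCStarAlgebra A] : Type _ :=
  StrongDual ℂ (StrongDual ℂ A)

/-- The Arens product on `A**`: `(F G)(φ) = F (a ↦ G (b ↦ φ (a b)))`. For a C*-algebra this is
the product of the enveloping von Neumann algebra. -/
noncomputable def arensMul {A : Type*} [NonUnitalCStarAlgebra A] (F G : Bidual A) : Bidual A :=
  F ∘L ((ContinuousLinearMap.compL ℂ A (StrongDual ℂ A) ℂ G) ∘L
    ((ContinuousLinearMap.compL ℂ A (A →L[ℂ] A) (StrongDual ℂ A)).flip
      (ContinuousLinearMap.mul ℂ A)) ∘L (ContinuousLinearMap.compL ℂ A A ℂ))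

/-- The canonical embedding of `A` into `A**`. -/
noncomputable abbrev toBidual {A : Type*} [NonUnitalCStarAlgebra A] (a : A) : Bidual A :=
  NormedSpace.inclusionInDoubleDual ℂ A a

theorem arensMul_apply {A : Type*} [NonUnitalCStarAlgebra A] (F G : Bidual A)
    (φ : StrongDual ℂ A) :
    arensMul F G φ =
      F (G ∘L (ContinuousLinearMap.compL ℂ A A ℂ φ) ∘L ContinuousLinearMap.mul ℂ A) := rfl

theorem arensMul_toBidual {A : Type*} [NonUnitalCStarAlgebra A] (a b : A) :
    arensMul (toBidual a) (toBidual b) = toBidual (a * b) := by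
  ext φ
  simp [arensMul_apply]

/-- Positive (bounded) linear functionals on `A`. -/
def IsPositiveFunctional {A : Type*} [NonUnitalCStarAlgebra A] (φ : StrongDual ℂ A) : Prop :=
  ∀ a : A, 0 ≤ φ (star a * a)

/-- For a commutative C*-subalgebra `M` of `A` and a subset `K` of its Gelfand spectrum
`characterSpace ℂ M`: the elements of `M` which, as functions on the spectrum, have values in
`[0, 1]` and are equal to `1` on `K` (positive contractions are written `star m * m`). -/
def cutoffs {A : Type*} [NonUnitalCStarAlgebra A] (M : NonUnitalStarSubalgebra ℂ A)
    (K : Set (characterSpace ℂ M)) : Set A :=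
  {f | ∃ m : M, f = star m * m ∧ ‖m‖ ≤ 1 ∧ ∀ χ ∈ K, χ (star m * m) = 1}

/-- The filter of tails of the decreasing net `cutoffs M K`; `h ≤ f` is expressed by
`f - h = star x * x`. -/
def cutoffFilter {A : Type*} [NonUnitalCStarAlgebra A] (M : NonUnitalStarSubalgebra ℂ A)
    (K : Set (characterSpace ℂ M)) : Filter A :=
  ⨅ f ∈ cutoffs M K, 𝓟 {h | h ∈ cutoffs M K ∧ ∃ x : A, f - h = star x * x}

/-- `p ∈ A**` is the indicator function of the compact set `K` of the spectrum of `M`: the weak*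
limit of the decreasing net of all `f ∈ M` with `1_K ≤ f ≤ 1`. (A functional on `A` restricts to
a Radon measure on the spectrum of `M`, and its value at `p` is the measure of `K`.) -/
def IsIndicator {A : Type*} [NonUnitalCStarAlgebra A] (M : NonUnitalStarSubalgebra ℂ A)
    (K : Set (characterSpace ℂ M)) (p : Bidual A) : Prop :=
  ∀ φ : StrongDual ℂ A, Tendsto φ (cutoffFilter M K) (𝓝 (p φ))

section
variable {A : Type*} [NonUnitalCStarAlgebra A]

theorem character_star (χ : characterSpace ℂ A) (a : A) : χ (star a) = star (χ a) := by
  let ψ : Unitization ℂ A →ₐ[ℂ] ℂ := Unitization.lift (CharacterSpace.toNonUnitalAlgHom χ)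
  have h : ψ (star (a : Unitization ℂ A)) = star (ψ (a : Unitization ℂ A)) := map_star ψ _
  rw [← Unitization.inr_star] at h
  simpa [ψ] using h

theorem exists_cutoff {g : A} (hg : IsSelfAdjoint g) {δ : ℝ} (hδ : 0 < δ) :
    ∃ m : A, ‖m‖ ≤ 1 ∧ ∀ (ψ : characterSpace ℂ A) (r : ℝ), δ ≤ r → ψ g = (r : ℂ) → ψ m = 1 := by
  obtain ⟨h, hhc, hh0, hh1, hh2⟩ : ∃ h : ℝ → ℝ, Continuous h ∧ h 0 = 0 ∧ (∀ x, ‖h x‖ ≤ 1) ∧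
      ∀ x, δ ≤ x → h x = 1 := by
    refine ⟨fun x => min 1 (|x| / δ), by fun_prop, by simp, fun x => ?_, fun x hx => ?_⟩
    · rw [Real.norm_of_nonneg (le_min zero_le_one (by positivity))]
      exact min_le_left _ _
    · apply min_eq_left
      rw [abs_of_pos (hδ.trans_le hx), le_div_iff₀ hδ]
      linarith
  refine ⟨cfcₙ h g, norm_cfcₙ_le fun x _ => hh1 x, fun ψ r hr hψ => ?_⟩
  let Ψ : A →⋆ₙₐ[ℂ] ℂ :=
    { CharacterSpace.toNonUnitalAlgHom ψ with map_star' := character_star ψ }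
  have hΨ : ∀ a, Ψ a = ψ a := fun a => rfl
  have hΨc : Continuous Ψ := map_continuous ψ
  rw [← hΨ, NonUnitalStarAlgHom.map_cfcₙ Ψ h g hhc.continuousOn hh0 hΨc hg
    (hg.map Ψ), hΨ, hψ, cfcₙ_eq_cfc hhc.continuousOn hh0]
  have := cfc_algebraMap (A := ℂ) r h
  rw [Complex.coe_algebraMap] at this
  rw [this, hh2 r hr]
  simp

theorem character_eventually_one (K : Set (characterSpace ℂ A)) (hK : IsCompact K) :
    ∃ m : A, ‖m‖ ≤ 1 ∧ ∀ χ ∈ K, χ (star m * m) = 1 := by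
  classical
  have hne : ∀ χ : characterSpace ℂ A, ∃ a : A, χ a ≠ 0 := by
    intro χ
    by_contra! h
    exact χ.2.1 (ContinuousLinearMap.ext h)
  choose b hb using hne
  have hcont : ∀ a : A, Continuous fun χ : characterSpace ℂ A => χ a := fun a =>
    (WeakDual.eval_continuous a).comp continuous_subtype_val
  obtain ⟨t, -, ht⟩ := hK.elim_nhds_subcover (fun χ => {ψ | ψ (b χ) ≠ 0})
    (fun χ _ => (isOpen_ne.preimage (hcont (b χ))).mem_nhds (hb χ))
  set g : A := ∑ χ ∈ t, star (b χ) * b χ with hg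
  have hgsa : IsSelfAdjoint g := by
    rw [hg]; exact isSelfAdjoint_sum _ fun χ _ => IsSelfAdjoint.star_mul_self _
  have hval : ∀ ψ : characterSpace ℂ A,
      ψ g = ((∑ χ ∈ t, ‖ψ (b χ)‖ ^ 2 : ℝ) : ℂ) := by
    intro ψ
    rw [hg, map_sum]
    push_cast
    refine Finset.sum_congr rfl fun χ _ => ?_
    rw [map_mul, character_star]
    simpa using Complex.conj_mul' (ψ (b χ))
  have hpos : ∀ ψ ∈ K, 0 < (∑ χ ∈ t, ‖ψ (b χ)‖ ^ 2 : ℝ) := by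
    intro ψ hψ
    obtain ⟨χ, hχ, hne⟩ := Set.mem_iUnion₂.1 (ht hψ)
    exact Finset.sum_pos' (fun _ _ => by positivity) ⟨χ, hχ, by
      have : 0 < ‖ψ (b χ)‖ := norm_pos_iff.2 hne
      positivity⟩
  rcases K.eq_empty_or_nonempty with rfl | hKne
  · exact ⟨0, by simp, by simp⟩
  have hc : ContinuousOn (fun ψ : characterSpace ℂ A => (∑ χ ∈ t, ‖ψ (b χ)‖ ^ 2 : ℝ)) K :=
    (continuous_finsetSum _ fun χ _ => ((hcont (b χ)).norm.pow 2)).continuousOn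
  obtain ⟨ψ₀, hψ₀, hmin⟩ := hK.exists_isMinOn hKne hc
  set δ : ℝ := ∑ χ ∈ t, ‖ψ₀ (b χ)‖ ^ 2 with hδ
  have hδ0 : 0 < δ := hpos ψ₀ hψ₀
  obtain ⟨m, hm, hmψ⟩ := exists_cutoff hgsa hδ0
  refine ⟨m, hm, fun ψ hψ => ?_⟩
  rw [map_mul, character_star, hmψ ψ _ (hmin hψ) (hval ψ)]
  simp

theorem cutoffs_bound (g : A →+ ℝ) (C : ℝ) (hg : ∀ x, |g x| ≤ C * ‖x‖) (f : ℕ → A)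
    (hf0 : ‖f 0‖ ≤ 1) (hf : ∀ n, ∃ x : A, f n = star x * x)
    (hd : ∀ n, ∃ x : A, f n - f (n + 1) = star x * x) (N : ℕ) :
    ∑ n ∈ Finset.range N, |g (f n - f (n + 1))| ≤ 2 * |C| := by
  classical
  let _ : PartialOrder A := CStarAlgebra.spectralOrder A
  have _ : StarOrderedRing A := CStarAlgebra.spectralOrderedRing A
  have hf' : ∀ n, 0 ≤ f n := fun n => CStarAlgebra.nonneg_iff_eq_star_mul_self.2 (hf n)
  have hd' : ∀ n, 0 ≤ f n - f (n + 1) := fun n =>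
    CStarAlgebra.nonneg_iff_eq_star_mul_self.2 (hd n)
  have hsub : ∀ s ⊆ Finset.range N, |g (∑ n ∈ s, (f n - f (n + 1)))| ≤ |C| := by
    intro s hs
    have h0 : 0 ≤ ∑ n ∈ s, (f n - f (n + 1)) := Finset.sum_nonneg fun n _ => hd' n
    have h1 : ∑ n ∈ s, (f n - f (n + 1)) ≤ f 0 := by
      refine (Finset.sum_le_sum_of_subset_of_nonneg hs fun n _ _ => hd' n).trans ?_
      rw [Finset.sum_range_sub']
      exact sub_le_self _ (hf' N)
    have h2 := (CStarAlgebra.norm_le_norm_of_nonneg_of_le h0 h1).trans hf0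
    refine (hg _).trans ?_
    nlinarith [le_abs_self C, abs_nonneg C, norm_nonneg (∑ n ∈ s, (f n - f (n + 1)))]
  have key : ∑ n ∈ Finset.range N, |g (f n - f (n + 1))| =
      g (∑ n ∈ Finset.range N with 0 ≤ g (f n - f (n + 1)), (f n - f (n + 1))) -
      g (∑ n ∈ Finset.range N with ¬ 0 ≤ g (f n - f (n + 1)), (f n - f (n + 1))) := by
    rw [← Finset.sum_filter_add_sum_filter_not (Finset.range N)
      (fun n => 0 ≤ g (f n - f (n + 1))), map_sum, map_sum, sub_eq_add_neg,
      ← Finset.sum_neg_distrib]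
    congr 1
    · exact Finset.sum_congr rfl fun n hn => abs_of_nonneg (Finset.mem_filter.1 hn).2
    · exact Finset.sum_congr rfl fun n hn =>
        abs_of_neg (not_le.1 (Finset.mem_filter.1 hn).2)
  rw [key]
  have h1 := hsub _ (Finset.filter_subset (fun n => 0 ≤ g (f n - f (n + 1))) (Finset.range N))
  have h2 := hsub _ (Finset.filter_subset (fun n => ¬ 0 ≤ g (f n - f (n + 1))) (Finset.range N))
  have h3 := abs_le.1 h1
  have h4 := abs_le.1 h2
  linarith

theorem cutoffs_le_one {M : NonUnitalStarSubalgebra ℂ A} {K : Set (characterSpace ℂ M)} {f : A}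
    (hf : f ∈ cutoffs M K) : ‖f‖ ≤ 1 := by
  obtain ⟨m, rfl, hm, -⟩ := hf
  have h : ‖star (m : A) * m‖ ≤ 1 := by
    rw [CStarRing.norm_star_mul_self]
    have h1 : ‖(m : A)‖ ≤ 1 := hm
    nlinarith [norm_nonneg (m : A)]
  exact h

theorem cutoffs_cauchy {M : NonUnitalStarSubalgebra ℂ A} {K : Set (characterSpace ℂ M)}
    (hne : (cutoffs M K).Nonempty) (φ : StrongDual ℂ A) {ε : ℝ} (hε : 0 < ε) :
    ∃ f ∈ cutoffs M K, ∀ h ∈ cutoffs M K, (∃ x : A, f - h = star x * x) → ‖φ f - φ h‖ < ε := by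
  by_contra! H
  choose! u hu1 hu2 hu3 using H
  obtain ⟨f₀, hf₀⟩ := hne
  let f : ℕ → A := fun n => u^[n] f₀
  have hfs : ∀ n, f (n + 1) = u (f n) := fun n => Function.iterate_succ_apply' u n f₀
  have hfm : ∀ n, f n ∈ cutoffs M K := by
    intro n
    induction n with
    | zero => exact hf₀
    | succ k ih => rw [hfs]; exact hu1 _ ih
  have hf : ∀ n, ∃ x : A, f n = star x * x := fun n => by
    obtain ⟨m, hm, -⟩ := hfm n
    exact ⟨m, hm⟩
  have hd : ∀ n, ∃ x : A, f n - f (n + 1) = star x * x := fun n => by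
    rw [hfs]; exact hu2 _ (hfm n)
  let g₁ : A →+ ℝ := Complex.reAddGroupHom.comp (φ : A →+ ℂ)
  let g₂ : A →+ ℝ := Complex.imAddGroupHom.comp (φ : A →+ ℂ)
  have b₁ := cutoffs_bound g₁ ‖φ‖ (fun x => (Complex.abs_re_le_norm _).trans (φ.le_opNorm x)) f
    (cutoffs_le_one hf₀) hf hd
  have b₂ := cutoffs_bound g₂ ‖φ‖ (fun x => (Complex.abs_im_le_norm _).trans (φ.le_opNorm x)) f
    (cutoffs_le_one hf₀) hf hd
  have hlow : ∀ n, ε ≤ |g₁ (f n - f (n + 1))| + |g₂ (f n - f (n + 1))| := by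
    intro n
    have h1 := hu3 _ (hfm n)
    rw [← hfs, ← map_sub] at h1
    exact h1.trans (Complex.norm_le_abs_re_add_abs_im _)
  obtain ⟨N, hN⟩ := exists_nat_gt (4 * |‖φ‖| / ε)
  have hsum : ∑ n ∈ Finset.range N, ε ≤
      ∑ n ∈ Finset.range N, (|g₁ (f n - f (n + 1))| + |g₂ (f n - f (n + 1))|) :=
    Finset.sum_le_sum fun n _ => hlow n
  rw [Finset.sum_add_distrib, Finset.sum_const, Finset.card_range, nsmul_eq_mul] at hsum
  rw [div_lt_iff₀ hε] at hN
  linarith [b₁ N, b₂ N]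

theorem cutoffs_directed {M : NonUnitalStarSubalgebra ℂ A}
    (hcomm : ∀ x ∈ M, ∀ y ∈ M, x * y = y * x) {K : Set (characterSpace ℂ M)} {f g : A}
    (hf : f ∈ cutoffs M K) (hg : g ∈ cutoffs M K) :
    ∃ h ∈ cutoffs M K, (∃ x : A, f - h = star x * x) ∧ ∃ x : A, g - h = star x * x := by
  have conj : ∀ x y : A, ‖y‖ ≤ 1 → ∃ z : A, star x * x - star (y * x) * (y * x) = star z * z := by
    intro x y hy
    let _ : PartialOrder A := CStarAlgebra.spectralOrder A
    have _ : StarOrderedRing A := CStarAlgebra.spectralOrderedRing A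
    have h1 : star x * (star y * y) * x ≤ ‖star y * y‖ • (star x * x) :=
      CStarAlgebra.star_left_conjugate_le_norm_smul (IsSelfAdjoint.star_mul_self y)
    have h2 : ‖star y * y‖ • (star x * x) ≤ (1 : ℝ) • (star x * x) := by
      apply smul_le_smul_of_nonneg_right _ (star_mul_self_nonneg x)
      rw [CStarRing.norm_star_mul_self]
      nlinarith [norm_nonneg y]
    have h3 := h1.trans h2
    rw [one_smul] at h3
    have h6 : star (y * x) * (y * x) = star x * (star y * y) * x := by
      rw [star_mul]; noncomm_ring
    rw [h6]
    exact CStarAlgebra.nonneg_iff_eq_star_mul_self.1 (sub_nonneg.2 h3)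
  obtain ⟨m, rfl, hm, hmK⟩ := hf
  obtain ⟨n, rfl, hn, hnK⟩ := hg
  have hle : ‖m * n‖ ≤ 1 := (norm_mul_le m n).trans (by nlinarith [norm_nonneg m, norm_nonneg n])
  have heq : star (m * n) * (m * n) = (star m * m) * (star n * n) := by
    apply Subtype.ext
    have c1 := hcomm (star (n : A)) (star n).2 (star m : M) (star m).2
    have c2 := hcomm (star (n : A)) (star n).2 (m : A) m.2
    simp only [MulMemClass.coe_mul, StarMemClass.coe_star, star_mul] at c1 ⊢
    calc star (n : A) * star (m : A) * (m * n) = star (m : A) * (star (n : A) * m) * n := by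
          rw [c1]; noncomm_ring
      _ = _ := by rw [c2]; noncomm_ring
  refine ⟨_, ⟨m * n, rfl, hle, fun χ hχ => ?_⟩, ?_, ?_⟩
  · rw [heq, map_mul, hmK χ hχ, hnK χ hχ, one_mul]
  · have h := conj (m : A) (n : A) hn
    have e : (m : A) * n = n * m := hcomm m m.2 n n.2
    rw [← e] at h
    exact h
  · exact conj (n : A) (m : A) hm

theorem mem_unitBall (F : StrongDual ℂ (StrongDual ℂ A)) (h : ‖F‖ ≤ 1) :
    F ∈ Metric.closedBall (0 : StrongDual ℂ (StrongDual ℂ A)) 1 := by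
  have := dist_zero_right F
  exact Metric.mem_closedBall.2 (this.trans_le h)

theorem exists_isIndicator (M : NonUnitalStarSubalgebra ℂ A) (hM : IsClosed (M : Set A))
    (hcomm : ∀ x ∈ M, ∀ y ∈ M, x * y = y * x) (K : Set (characterSpace ℂ M))
    (hK : IsCompact K) : (cutoffFilter M K).NeBot ∧ ∃ p, IsIndicator M K p := by
  have : IsClosed (M : Set A) := hM
  obtain ⟨m₀, hm₀, hm₀K⟩ := character_eventually_one K hK
  have hne : (cutoffs M K).Nonempty := ⟨_, m₀, rfl, hm₀, hm₀K⟩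
  have hbasis : (cutoffFilter M K).HasBasis (fun f => f ∈ cutoffs M K)
      (fun f => {h | h ∈ cutoffs M K ∧ ∃ x : A, f - h = star x * x}) := by
    refine hasBasis_biInf_principal ?_ hne
    intro f hf g hg
    obtain ⟨h, hh, hfh, hgh⟩ := cutoffs_directed hcomm hf hg
    let _ : PartialOrder A := CStarAlgebra.spectralOrder A
    have _ : StarOrderedRing A := CStarAlgebra.spectralOrderedRing A
    rw [← CStarAlgebra.nonneg_iff_eq_star_mul_self, sub_nonneg] at hfh hgh
    refine ⟨h, hh, ?_, ?_⟩
    · rintro k ⟨hk, hhk⟩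
      rw [← CStarAlgebra.nonneg_iff_eq_star_mul_self, sub_nonneg] at hhk
      refine ⟨hk, ?_⟩
      rw [← CStarAlgebra.nonneg_iff_eq_star_mul_self, sub_nonneg]
      exact hhk.trans hfh
    · rintro k ⟨hk, hhk⟩
      rw [← CStarAlgebra.nonneg_iff_eq_star_mul_self, sub_nonneg] at hhk
      refine ⟨hk, ?_⟩
      rw [← CStarAlgebra.nonneg_iff_eq_star_mul_self, sub_nonneg]
      exact hhk.trans hgh
  have hNB : (cutoffFilter M K).NeBot :=
    hbasis.neBot_iff.2 fun {f} hf => ⟨f, hf, 0, by simp⟩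
  refine ⟨hNB, ?_⟩
  let ι : A → WeakDual ℂ (StrongDual ℂ A) := fun a => StrongDual.toWeakDual (toBidual a)
  have hmem : ∀ᶠ f in cutoffFilter M K,
      ι f ∈ toStrongDual ⁻¹' Metric.closedBall (0 : StrongDual ℂ (StrongDual ℂ A)) 1 := by
    refine hbasis.eventually_iff.2 ⟨_, ⟨m₀, rfl, hm₀, hm₀K⟩, fun {f} hf => ?_⟩
    have h3 : ‖toBidual f‖ ≤ 1 :=
      (NormedSpace.double_dual_bound ℂ A f).trans (cutoffs_le_one hf.1)
    exact mem_unitBall _ h3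
  obtain ⟨p, -, hp⟩ := (WeakDual.isCompact_closedBall
    (0 : StrongDual ℂ (StrongDual ℂ A)) 1).exists_mapClusterPt_of_frequently hmem.frequently
  refine ⟨toStrongDual p, fun φ => ?_⟩
  have hcl : MapClusterPt (p φ) (cutoffFilter M K) φ :=
    hp.continuousAt_comp (f := fun q : WeakDual ℂ (StrongDual ℂ A) => q φ)
      (WeakDual.eval_continuous φ).continuousAt
  refine le_nhds_of_cauchy_adhp ?_ hcl
  refine Metric.cauchy_iff.2 ⟨hNB.map _, fun ε hε => ?_⟩
  obtain ⟨f, hf, hfε⟩ := cutoffs_cauchy hne φ (half_pos hε)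
  refine ⟨φ '' {h | h ∈ cutoffs M K ∧ ∃ x : A, f - h = star x * x},
    image_mem_map (hbasis.mem_of_mem hf), ?_⟩
  rintro _ ⟨h, ⟨hh, hfh⟩, rfl⟩ _ ⟨k, ⟨hk, hfk⟩, rfl⟩
  have e1 := hfε h hh hfh
  have e2 := hfε k hk hfk
  rw [← dist_eq_norm] at e1 e2
  calc dist (φ h) (φ k) ≤ dist (φ f) (φ h) + dist (φ f) (φ k) := dist_triangle_left _ _ _
    _ < ε := by linarith
end

/-- The projection `1_K` of `A**`; for compact `K` see `isIndicator_indicator`. -/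
noncomputable def indicator {A : Type*} [NonUnitalCStarAlgebra A]
    (M : NonUnitalStarSubalgebra ℂ A) (K : Set (characterSpace ℂ M)) : Bidual A :=
  Classical.epsilon (IsIndicator M K)

theorem isIndicator_indicator {A : Type*} [NonUnitalCStarAlgebra A]
    (M : NonUnitalStarSubalgebra ℂ A) (hM : IsClosed (M : Set A))
    (hcomm : ∀ x ∈ M, ∀ y ∈ M, x * y = y * x) (K : Set (characterSpace ℂ M))
    (hK : IsCompact K) : IsIndicator M K (indicator M K) :=
  Classical.epsilon_spec (exists_isIndicator M hM hcomm K hK).2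

theorem IsIndicator.unique {A : Type*} [NonUnitalCStarAlgebra A]
    {M : NonUnitalStarSubalgebra ℂ A} (hM : IsClosed (M : Set A))
    (hcomm : ∀ x ∈ M, ∀ y ∈ M, x * y = y * x) {K : Set (characterSpace ℂ M)}
    (hK : IsCompact K) {p q : Bidual A} (hp : IsIndicator M K p) (hq : IsIndicator M K q) :
    p = q := by
  have := (exists_isIndicator M hM hcomm K hK).1
  exact ContinuousLinearMap.ext fun φ => tendsto_nhds_unique (hp φ) (hq φ)

/-- The corner `1_K a 1_K` in `A**`. -/
noncomputable def corner {A : Type*} [NonUnitalCStarAlgebra A]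
    (M : NonUnitalStarSubalgebra ℂ A) (K : Set (characterSpace ℂ M)) (a : A) : Bidual A :=
  arensMul (indicator M K) (arensMul (toBidual a) (indicator M K))

/-! ### States and extended metrics -/

/-- The state space of `A`, with the weak* topology of the ambient space. -/
def states (A : Type*) [NonUnitalCStarAlgebra A] : Set (WeakDual ℂ A) :=
  {φ | IsPositiveFunctional (toStrongDual φ) ∧ ‖toStrongDual φ‖ = 1}

/-- The states `φ` with `φ (1_K) = 1`. -/
def statesOn {A : Type*} [NonUnitalCStarAlgebra A] (M : NonUnitalStarSubalgebra ℂ A)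
    (K : Set (characterSpace ℂ M)) : Set (WeakDual ℂ A) :=
  {φ | φ ∈ states A ∧ indicator M K (toStrongDual φ) = 1}

/-- The topology generated by the open balls of an extended metric `d`. -/
abbrev ballTopology {X : Type*} (d : X → X → ℝ≥0∞) : TopologicalSpace X :=
  TopologicalSpace.generateFrom {U | ∃ (x : X) (r : ℝ≥0∞), U = {y | d y x < r}}

/-- `S ⊆_ε T` with respect to `d`. -/
def AlmostSubset {X : Type*} (d : X → X → ℝ≥0∞) (ε : ℝ) (S T : Set X) : Prop :=
  ∀ s ∈ S, ∃ t ∈ T, d s t ≤ ENNReal.ofReal ε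

/-- The Hausdorff distance (possibly infinite) with respect to `d`. -/
noncomputable def hausdorff {X : Type*} (d : X → X → ℝ≥0∞) (S T : Set X) : ℝ≥0∞ :=
  ⨅ (ε : ℝ) (_ : 0 < ε ∧ AlmostSubset d ε S T ∧ AlmostSubset d ε T S), ENNReal.ofReal ε

/-- The Monge-Kantorovich extended metric of `L`. -/
noncomputable def kantorovich {A : Type*} [NonUnitalCStarAlgebra A] (L : A → ℝ≥0∞)
    (φ ψ : WeakDual ℂ A) : ℝ≥0∞ :=
  ⨆ (a : A) (_ : IsSelfAdjoint a ∧ L a ≤ 1), ‖φ a - ψ a‖ₑ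

/-- The Monge-Kantorovich extended metric of the restriction of `L` to `M`, for arbitrary
functions on `M`. -/
noncomputable def subKantorovich {A : Type*} [NonUnitalCStarAlgebra A] (L : A → ℝ≥0∞)
    (M : NonUnitalStarSubalgebra ℂ A) (f g : M → ℂ) : ℝ≥0∞ :=
  ⨆ (m : M) (_ : IsSelfAdjoint m ∧ L m ≤ 1), ‖f m - g m‖ₑ

/-- The Monge-Kantorovich extended metric, on the Gelfand spectrum of `M`, of the restriction of
`L` to `M`. -/
noncomputable def specKantorovich {A : Type*} [NonUnitalCStarAlgebra A] (L : A → ℝ≥0∞)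
    (M : NonUnitalStarSubalgebra ℂ A) (χ ψ : characterSpace ℂ M) : ℝ≥0∞ :=
  subKantorovich L M χ ψ

/-- The diameter of the Gelfand spectrum of `M` for `specKantorovich`. -/
noncomputable def specDiam {A : Type*} [NonUnitalCStarAlgebra A] (L : A → ℝ≥0∞)
    (M : NonUnitalStarSubalgebra ℂ A) : ℝ≥0∞ :=
  ⨆ (χ : characterSpace ℂ M) (ψ : characterSpace ℂ M), specKantorovich L M χ ψ

/-- Closed balls of the Gelfand spectrum of `M`. -/
def specBall {A : Type*} [NonUnitalCStarAlgebra A] (L : A → ℝ≥0∞)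
    (M : NonUnitalStarSubalgebra ℂ A) (χ : characterSpace ℂ M) (r : ℝ) :
    Set (characterSpace ℂ M) :=
  {ψ | specKantorovich L M ψ χ ≤ ENNReal.ofReal r}

/-- The Monge-Kantorovich metric of `L` metrizes the weak* topology of the set `S`. -/
def Metrizes {A : Type*} [NonUnitalCStarAlgebra A] (L : A → ℝ≥0∞) (S : Set (WeakDual ℂ A)) :
    Prop :=
  ballTopology (fun φ ψ : S => kantorovich L φ ψ) = (instTopologicalSpaceSubtype : TopologicalSpace S)

/-! ### Lipschitz pairs, topographies, quantum metric spaces -/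

/-- `A` has a unit. -/
def HasUnit (A : Type*) [NonUnitalCStarAlgebra A] : Prop :=
  ∃ e : A, ∀ a : A, e * a = a ∧ a * e = a

/-- Lipschitz pairs. The seminorm is extended by `L a = ∞` outside of its domain, a dense subspace
of the self-adjoint part of `A`. Its zero set consists of the self-adjoint elements that are real
multiples of the unit of the smallest unital C*-algebra containing `A`: the real multiples of `1`
if `A` is unital, and only `0` otherwise. A seminorm `L` on a dense subspace of the self-adjoint
part of the smallest unital C*-algebra containing `A` with zero set `ℝ1` is the same thing, being
determined by `L (a + t 1) = L a`. -/
structure IsLipschitzPair {A : Type*} [NonUnitalCStarAlgebra A] (L : A → ℝ≥0∞) : Prop where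
  isSelfAdjoint : ∀ a, L a ≠ ⊤ → IsSelfAdjoint a
  add_le : ∀ a b, L (a + b) ≤ L a + L b
  smul : ∀ (t : ℝ) (a : A), L a ≠ ⊤ → L ((t : ℂ) • a) = ENNReal.ofReal |t| * L a
  dense : ∀ a, IsSelfAdjoint a → a ∈ closure {b | L b ≠ ⊤}
  eq_zero_iff : ∀ a, L a = 0 ↔
    IsSelfAdjoint a ∧ ∃ t : ℝ, ∀ b, a * b = (t : ℂ) • b ∧ b * a = (t : ℂ) • b

/-- The Jordan product `(ab + ba)/2`. -/
noncomputable def jordan {A : Type*} [NonUnitalCStarAlgebra A] (a b : A) : A :=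
  (1 / 2 : ℂ) • (a * b + b * a)

/-- The Lie product `(ab - ba)/(2i)`. -/
noncomputable def lie {A : Type*} [NonUnitalCStarAlgebra A] (a b : A) : A :=
  (1 / (2 * Complex.I) : ℂ) • (a * b - b * a)

/-- The Leibniz inequalities on a set `S`. -/
def LeibnizOn {A : Type*} [NonUnitalCStarAlgebra A] (L : A → ℝ≥0∞) (S : Set A) : Prop :=
  ∀ a ∈ S, ∀ b ∈ S, L (jordan a b) ≤ ‖a‖ₑ * L b + L a * ‖b‖ₑ ∧
    L (lie a b) ≤ ‖a‖ₑ * L b + L a * ‖b‖ₑ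

/-- Leibniz Lipschitz pairs. -/
def IsLeibnizLipschitzPair {A : Type*} [NonUnitalCStarAlgebra A] (L : A → ℝ≥0∞) : Prop :=
  IsLipschitzPair L ∧ LeibnizOn L {a | IsSelfAdjoint a}

/-- Leibniz quantum compact metric spaces. -/
structure IsLeibnizQCMS {A : Type*} [NonUnitalCStarAlgebra A] (L : A → ℝ≥0∞) : Prop where
  leibniz : IsLeibnizLipschitzPair L
  hasUnit : HasUnit A
  lsc : LowerSemicontinuous L
  metrizes : Metrizes L (states A)

/-- `M` is a topography on `A`: a commutative C*-subalgebra containing an approximate unit. -/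
structure IsTopography {A : Type*} [NonUnitalCStarAlgebra A]
    (M : NonUnitalStarSubalgebra ℂ A) : Prop where
  isClosed : IsClosed (M : Set A)
  comm : ∀ x ∈ M, ∀ y ∈ M, x * y = y * x
  approxUnit : ∃ l : Filter A, l.IsApproximateUnit ∧ (M : Set A) ∈ l

/-- Tame sets of states. -/
def IsTame {A : Type*} [NonUnitalCStarAlgebra A] (L : A → ℝ≥0∞)
    (M : NonUnitalStarSubalgebra ℂ A) (S : Set (WeakDual ℂ A)) : Prop :=
  Tendsto (fun K : TopologicalSpace.Compacts (characterSpace ℂ M) =>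
    ⨆ (φ : WeakDual ℂ A) (_ : φ ∈ S) (a : A) (_ : IsSelfAdjoint a ∧ L a ≤ 1),
      ‖(toBidual a - corner M K a) (toStrongDual φ)‖ₑ) atTop (𝓝 0)

/-- Quantum locally compact metric spaces. -/
structure IsQLCMS {A : Type*} [NonUnitalCStarAlgebra A] (L : A → ℝ≥0∞)
    (M : NonUnitalStarSubalgebra ℂ A) : Prop where
  lipschitz : IsLipschitzPair L
  topography : IsTopography M
  metrizes : ∀ S ⊆ states A, IsTame L M S → Metrizes L S

/-- The self-adjoint `a` with `1_K a 1_K = a` and `L a < ∞`. -/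
def Loc {A : Type*} [NonUnitalCStarAlgebra A] (L : A → ℝ≥0∞)
    (M : NonUnitalStarSubalgebra ℂ A) (K : Set (characterSpace ℂ M)) : Set A :=
  {a | IsSelfAdjoint a ∧ corner M K a = toBidual a ∧ L a < ⊤}

/-- The Lipschitz locally supported elements. -/
def LocStar {A : Type*} [NonUnitalCStarAlgebra A] (L : A → ℝ≥0∞)
    (M : NonUnitalStarSubalgebra ℂ A) : Set A :=
  {a | ∃ K : Set (characterSpace ℂ M), IsCompact K ∧ a ∈ Loc L M K}

/-- Proper quantum metric spaces. -/
structure IsProperQMS {A : Type*} [NonUnitalCStarAlgebra A] (L : A → ℝ≥0∞)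
    (M : NonUnitalStarSubalgebra ℂ A) : Prop where
  qlcms : IsQLCMS L M
  separable : TopologicalSpace.SeparableSpace A
  leibniz : IsLeibnizLipschitzPair L
  lsc : LowerSemicontinuous L
  dense : {a | L a < ⊤} ⊆ closure (LocStar L M)
  dense_topography : {a | a ∈ M ∧ IsSelfAdjoint a} ⊆ closure (LocStar L M ∩ M)
  finite : ∀ χ ψ, specKantorovich L M χ ψ < ⊤
  proper : ∀ χ r, @IsCompact _ (ballTopology (specKantorovich L M)) (specBall L M χ r)

/-- A Lip-norm, a topography and a base point on `A`. -/
structure PointedTriple (A : Type*) [NonUnitalCStarAlgebra A] where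
  L : A → ℝ≥0∞
  M : NonUnitalStarSubalgebra ℂ A
  base : characterSpace ℂ M

/-- `Loc` for the closed ball of radius `r` at the base point. -/
def PointedTriple.locBall {A : Type*} [NonUnitalCStarAlgebra A] (X : PointedTriple A) (r : ℝ) :
    Set A :=
  Loc X.L X.M (specBall X.L X.M X.base r)

/-- `statesOn` for the closed ball of radius `r` at the base point. -/
def PointedTriple.statesBall {A : Type*} [NonUnitalCStarAlgebra A] (X : PointedTriple A) (r : ℝ) :
    Set (WeakDual ℂ A) :=
  statesOn X.M (specBall X.L X.M X.base r)

/-! ### Passages and tunnels -/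

/-- A *-morphism is topographic when it maps the topography into the topography and some
approximate unit in the topography to an approximate unit. Surjectivity is not part of this
definition. -/
structure IsTopographic {D A : Type*} [NonUnitalCStarAlgebra D] [NonUnitalCStarAlgebra A]
    (N : NonUnitalStarSubalgebra ℂ D) (M : NonUnitalStarSubalgebra ℂ A) (π : D →⋆ₙₐ[ℂ] A) :
    Prop where
  maps : ∀ d ∈ N, π d ∈ M
  approxUnit : ∃ l : Filter D, l.IsApproximateUnit ∧ (N : Set D) ∈ l ∧
    (l.map π).IsApproximateUnit

/-- Passages from `X` to `Y` with underlying C*-algebra `D`. -/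
structure Passage {A B : Type*} [NonUnitalCStarAlgebra A] [NonUnitalCStarAlgebra B]
    (X : PointedTriple A) (Y : PointedTriple B) (D : Type*) [NonUnitalCStarAlgebra D] where
  L : D → ℝ≥0∞
  M : NonUnitalStarSubalgebra ℂ D
  left : D →⋆ₙₐ[ℂ] A
  right : D →⋆ₙₐ[ℂ] B
  qlcms : IsQLCMS L M
  lsc : LowerSemicontinuous L
  topographic_left : IsTopographic M X.M left
  topographic_right : IsTopographic M Y.M right

/-- The image of a set of functionals under `φ ↦ φ ∘ π`. -/
def pullback {D A : Type*} [NonUnitalCStarAlgebra D] [NonUnitalCStarAlgebra A]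
    (π : D →⋆ₙₐ[ℂ] A) (S : Set (WeakDual ℂ A)) : Set (WeakDual ℂ D) :=
  {ψ | ∃ φ ∈ S, ∀ d, ψ d = φ (π d)}

namespace Passage

/-- The inverse passage. -/
def symm {A B D : Type*} [NonUnitalCStarAlgebra A] [NonUnitalCStarAlgebra B]
    [NonUnitalCStarAlgebra D] {X : PointedTriple A} {Y : PointedTriple B} (τ : Passage X Y D) :
    Passage Y X D where
  L := τ.L
  M := τ.M
  left := τ.right
  right := τ.left
  qlcms := τ.qlcms
  lsc := τ.lsc
  topographic_left := τ.topographic_right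
  topographic_right := τ.topographic_left

/-- The lift set of `a` associated with `(l, r, ε, K)`. -/
def liftSet {A B D : Type*} [NonUnitalCStarAlgebra A] [NonUnitalCStarAlgebra B]
    [NonUnitalCStarAlgebra D] {X : PointedTriple A} {Y : PointedTriple B} (τ : Passage X Y D)
    (a : A) (l : ℝ≥0∞) (r ε : ℝ) (K : Set (characterSpace ℂ τ.M)) : Set D :=
  {d | d ∈ Loc τ.L τ.M K ∧ τ.left d = a ∧ τ.right d ∈ Y.locBall (r + 4 * ε) ∧ τ.L d ≤ l}

/-- The target set of `a` associated with `(l, r, ε, K)`. -/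
def targetSet {A B D : Type*} [NonUnitalCStarAlgebra A] [NonUnitalCStarAlgebra B]
    [NonUnitalCStarAlgebra D] {X : PointedTriple A} {Y : PointedTriple B} (τ : Passage X Y D)
    (a : A) (l : ℝ≥0∞) (r ε : ℝ) (K : Set (characterSpace ℂ τ.M)) : Set B :=
  τ.right '' τ.liftSet a l r ε K

/-- `(ε, K)` is `r`-left admissible. -/
structure IsLeftAdmissible {A B D : Type*} [NonUnitalCStarAlgebra A] [NonUnitalCStarAlgebra B]
    [NonUnitalCStarAlgebra D] {X : PointedTriple A} {Y : PointedTriple B} (τ : Passage X Y D)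
    (r ε : ℝ) (K : Set (characterSpace ℂ τ.M)) : Prop where
  pos : 0 < ε
  isCompact : IsCompact K
  pullback_subset : pullback τ.left (X.statesBall r) ⊆ statesOn τ.M K
  almostSubset : AlmostSubset (kantorovich τ.L) ε (statesOn τ.M K)
    (pullback τ.left (X.statesBall (r + 4 * ε)))
  target_nonempty : ∀ a ∈ X.locBall r, (τ.targetSet a (X.L a) r ε K).Nonempty
  target_topography : ∀ a ∈ X.locBall r ∩ X.M, (τ.targetSet a (X.L a) r ε K ∩ Y.M).Nonempty
  right_le : ∀ d ∈ Loc τ.L τ.M K, Y.L (τ.right d) ≤ τ.L d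

/-- The character `χ ∘ π` of the topography of `D`, as a function. -/
noncomputable def baseComp {D A : Type*} [NonUnitalCStarAlgebra D] [NonUnitalCStarAlgebra A]
    {N : NonUnitalStarSubalgebra ℂ D} {M : NonUnitalStarSubalgebra ℂ A} {π : D →⋆ₙₐ[ℂ] A}
    (h : IsTopographic N M π) (χ : characterSpace ℂ M) (d : N) : ℂ :=
  χ ⟨π d, h.maps d d.2⟩

/-- `(ε, K)` is `r`-admissible. -/
structure IsAdmissiblePair {A B D : Type*} [NonUnitalCStarAlgebra A] [NonUnitalCStarAlgebra B]
    [NonUnitalCStarAlgebra D] {X : PointedTriple A} {Y : PointedTriple B} (τ : Passage X Y D)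
    (r ε : ℝ) (K : Set (characterSpace ℂ τ.M)) : Prop where
  left : τ.IsLeftAdmissible r ε K
  right : τ.symm.IsLeftAdmissible r ε K
  base : subKantorovich τ.L τ.M (baseComp τ.topographic_left X.base)
    (baseComp τ.topographic_right Y.base) ≤ ENNReal.ofReal ε
  leibniz : LeibnizOn τ.L (Loc τ.L τ.M K)

/-- The set of `r`-admissible numbers. -/
def Adm {A B D : Type*} [NonUnitalCStarAlgebra A] [NonUnitalCStarAlgebra B]
    [NonUnitalCStarAlgebra D] {X : PointedTriple A} {Y : PointedTriple B} (τ : Passage X Y D)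
    (r : ℝ) : Set ℝ :=
  {ε | 0 < ε ∧ ∃ K : ℝ → Set (characterSpace ℂ τ.M), MonotoneOn K (Set.Ioc 0 r) ∧
    ∀ t ∈ Set.Ioc 0 r, τ.IsAdmissiblePair t ε (K t)}

/-- `τ` is an `r`-tunnel. -/
def IsTunnel {A B D : Type*} [NonUnitalCStarAlgebra A] [NonUnitalCStarAlgebra B]
    [NonUnitalCStarAlgebra D] {X : PointedTriple A} {Y : PointedTriple B} (τ : Passage X Y D)
    (r : ℝ) : Prop :=
  0 < r ∧ (τ.Adm r).Nonempty

/-- The `r`-extent of an `r`-tunnel. -/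
noncomputable def extent {A B D : Type*} [NonUnitalCStarAlgebra A] [NonUnitalCStarAlgebra B]
    [NonUnitalCStarAlgebra D] {X : PointedTriple A} {Y : PointedTriple B} (τ : Passage X Y D)
    (r : ℝ) : ℝ :=
  sInf (τ.Adm r)

end Passage

/-! ### Tunnels between Leibniz quantum compact metric spaces -/

/-- `L_A a = inf {L_D d : d self-adjoint, π d = a}` for all self-adjoint `a`. -/
def IsQuotientLip {D A : Type*} [NonUnitalCStarAlgebra D] [NonUnitalCStarAlgebra A]
    (LD : D → ℝ≥0∞) (LA : A → ℝ≥0∞) (π : D →⋆ₙₐ[ℂ] A) : Prop :=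
  ∀ a : A, IsSelfAdjoint a → LA a = ⨅ (d : D) (_ : IsSelfAdjoint d ∧ π d = a), LD d

/-- Tunnels `(D, L_D, π, ρ)` between Leibniz quantum compact metric spaces, as used for the dual
Gromov-Hausdorff propinquity. -/
structure IsCompactTunnel {D A B : Type*} [NonUnitalCStarAlgebra D] [NonUnitalCStarAlgebra A]
    [NonUnitalCStarAlgebra B] (LD : D → ℝ≥0∞) (LA : A → ℝ≥0∞) (LB : B → ℝ≥0∞)
    (π : D →⋆ₙₐ[ℂ] A) (ρ : D →⋆ₙₐ[ℂ] B) : Prop where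
  isLeibnizQCMS : IsLeibnizQCMS LD
  surjective_left : Function.Surjective π
  surjective_right : Function.Surjective ρ
  quotient_left : IsQuotientLip LD LA π
  quotient_right : IsQuotientLip LD LB ρ

/-- The extent of a tunnel: the larger of the Hausdorff distances, in the state space of `D`,
between all states and the states that factor through `π`, respectively `ρ`. -/
noncomputable def compactExtent {D A B : Type*} [NonUnitalCStarAlgebra D]
    [NonUnitalCStarAlgebra A] [NonUnitalCStarAlgebra B] (LD : D → ℝ≥0∞)
    (π : D →⋆ₙₐ[ℂ] A) (ρ : D →⋆ₙₐ[ℂ] B) : ℝ≥0∞ :=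
  max (hausdorff (kantorovich LD) (states D) (pullback π (states A)))
    (hausdorff (kantorovich LD) (states D) (pullback ρ (states B)))

/-- The length of a tunnel: the maximum of its reach and of its depth. -/
noncomputable def compactLength {D A B : Type*} [NonUnitalCStarAlgebra D]
    [NonUnitalCStarAlgebra A] [NonUnitalCStarAlgebra B] (LD : D → ℝ≥0∞)
    (π : D →⋆ₙₐ[ℂ] A) (ρ : D →⋆ₙₐ[ℂ] B) : ℝ≥0∞ :=
  max (hausdorff (kantorovich LD) (pullback π (states A)) (pullback ρ (states B)))
    (hausdorff (kantorovich LD) (states D)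
      (closure (convexHull ℝ (pullback π (states A) ∪ pullback ρ (states B)))))

/-- The topography `ℂ1` of a unital C*-algebra. -/
def scalars (A : Type*) [CStarAlgebra A] : NonUnitalStarSubalgebra ℂ A where
  carrier := Set.range (algebraMap ℂ A)
  add_mem' := by
    rintro _ _ ⟨z, rfl⟩ ⟨w, rfl⟩
    exact ⟨z + w, map_add _ _ _⟩
  zero_mem' := ⟨0, map_zero _⟩
  mul_mem' := by
    rintro _ _ ⟨z, rfl⟩ ⟨w, rfl⟩
    exact ⟨z * w, map_mul _ _ _⟩
  smul_mem' := by
    rintro c _ ⟨z, rfl⟩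
    exact ⟨c * z, by rw [map_mul, Algebra.smul_def]⟩
  star_mem' := by
    rintro _ ⟨z, rfl⟩
    exact ⟨star z, algebraMap_star_comm z⟩

/-- The number `t` such that `m = t1`. -/
noncomputable def scalarsCoeff {A : Type*} [CStarAlgebra A] (m : scalars A) : ℂ :=
  Classical.choose m.2

theorem algebraMap_scalarsCoeff {A : Type*} [CStarAlgebra A] (m : scalars A) :
    algebraMap ℂ A (scalarsCoeff m) = m :=
  Classical.choose_spec m.2

/-- The character `t1 ↦ t` of `ℂ1`. -/
noncomputable def scalarsBase (A : Type*) [CStarAlgebra A] [Nontrivial A] :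
    characterSpace ℂ (scalars A) :=
  have inj : Function.Injective (algebraMap ℂ A) := FaithfulSMul.algebraMap_injective ℂ A
  ⟨StrongDual.toWeakDual (LinearMap.mkContinuous
    { toFun := scalarsCoeff
      map_add' := fun x y => inj (by
        rw [map_add, algebraMap_scalarsCoeff, algebraMap_scalarsCoeff, algebraMap_scalarsCoeff]
        rfl)
      map_smul' := fun c x => inj (by
        rw [algebraMap_scalarsCoeff, RingHom.id_apply, smul_eq_mul, map_mul,
          algebraMap_scalarsCoeff, ← Algebra.smul_def]
        rfl) } 1
    (fun x => by
      have h := congrArg norm (algebraMap_scalarsCoeff x)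
      rw [norm_algebraMap'] at h
      rw [one_mul]
      exact h.le)), by
    constructor
    · intro h
      have h1 := DFunLike.congr_fun h (⟨algebraMap ℂ A 1, 1, rfl⟩ : scalars A)
      have h2 : scalarsCoeff (⟨algebraMap ℂ A 1, 1, rfl⟩ : scalars A) = 0 := h1
      have h3 := algebraMap_scalarsCoeff (⟨algebraMap ℂ A 1, 1, rfl⟩ : scalars A)
      rw [h2] at h3
      exact zero_ne_one (inj h3)
    · intro x y
      refine inj ?_
      change algebraMap ℂ A (scalarsCoeff (x * y)) =
        algebraMap ℂ A (scalarsCoeff x * scalarsCoeff y)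
      rw [map_mul, algebraMap_scalarsCoeff, algebraMap_scalarsCoeff, algebraMap_scalarsCoeff]
      rfl⟩

theorem algebraMap_scalarsBase {A : Type*} [CStarAlgebra A] [Nontrivial A] (m : scalars A) :
    algebraMap ℂ A (scalarsBase A m) = m :=
  algebraMap_scalarsCoeff m

/-- The pointed space with topography `ℂ1` associated with a quantum compact metric space. -/
noncomputable def canonicalTriple {A : Type*} [CStarAlgebra A] [Nontrivial A] (L : A → ℝ≥0∞) :
    PointedTriple A where
  L := L
  M := scalars A
  base := scalarsBase A

end QuantumMetric

namespace QuantumMetric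

open WeakDual Topology Filter
open scoped ENNReal ComplexOrder

/-! ### States of unital C*-algebras -/

/-! If the spectrum of `M_j` has diameter at most `r`, the ball of radius `r` about the base point
is the whole spectrum. Properness makes it compact for the metric. Lipschitz elements are dense in
the self-adjoint part of `M_j`, so the Gelfand topology is coarser than the metric one and the
spectrum is compact there too. Hence `M_j` has a unit, which is a unit of `A_j` because `M_j`
contains an approximate unit.

The main point is to lift this unit (`Passage.IsLeftAdmissible.exists_lift_one`). Since `1` has
Lip-norm `0`, admissibility yields `d` with `L_D(d) = 0` and `π_j(d) = 1`. So `d` acts as a nonzero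
scalar and `D` is unital. As `d` is supported on `K`, one gets `1_K 1_K = 1`, which forces `K` to be
the whole spectrum (`Passage.IsLeftAdmissible.eq_univ`). Localisation then disappears: every state
is carried by `K`, every Lipschitz element is local, every set of states is tame. The lifting
condition and the contraction condition of the inverse passage say that `L_j` is the quotient of
`L_D`. Surjectivity follows because ranges of *-morphisms are closed. The other algebra receives a
unit as the image of `1`.

For the corollary, the spectrum of `ℂ1` is a point, so all radii behave alike. For a compact tunnel,
`ε` is admissible exactly when all states of `D` are `ε`-close to states factoring through either
morphism (`mem_adm_iff`), so the infimum is the extent for every `r`. The substantial direction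
needs lifts that attain the quotient seminorm. They exist because norm-bounded Lipschitz balls are
compact (`isCompact_lipschitzBall`, by Arzelà–Ascoli on the state space). Finite length and finite
extent agree because the Monge–Kantorovich metric is jointly convex. -/

theorem HasUnit.exists_cstarAlgebra {A : Type*} [i : NonUnitalCStarAlgebra A] (h : HasUnit A) :
    ∃ inst : CStarAlgebra A, @CStarAlgebra.toNonUnitalCStarAlgebra A inst = i := by
  obtain ⟨e, he⟩ := h
  let _ : Ring A := { i with
    one := e
    one_mul := fun a => (he a).1
    mul_one := fun a => (he a).2 }
  let _ : Algebra ℂ A := Algebra.ofModule (fun r x y => smul_mul_assoc r x y)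
    (fun r x y => mul_smul_comm r x y)
  -- All remaining structure is taken from `i`, so forgetting the unit gives `i` back by `rfl`.
  -- Destructuring this equation later makes an algebra unital without altering anything already
  -- said about it.
  exact ⟨{ i with
    one := e
    one_mul := fun a => (he a).1
    mul_one := fun a => (he a).2
    algebraMap := algebraMap ℂ A
    commutes' := Algebra.commutes
    smul_def' := Algebra.smul_def }, rfl⟩

theorem hasUnit_of_cstarAlgebra (A : Type*) [CStarAlgebra A] : HasUnit A :=
  ⟨1, fun a => ⟨one_mul a, mul_one a⟩⟩

section Unital
variable {A : Type*} [CStarAlgebra A]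

theorem norm_smul_one_sub_le {a : A} {c : ℝ} (hc : ‖a‖ * ‖a‖ ≤ c) :
    ‖(c : ℂ) • (1 : A) - star a * a‖ ≤ c := by
  let _ : PartialOrder A := CStarAlgebra.spectralOrder A
  have _ : StarOrderedRing A := CStarAlgebra.spectralOrderedRing A
  have e : (c : ℂ) • (1 : A) = algebraMap ℝ A c := by
    rw [Algebra.algebraMap_eq_smul_one, Complex.coe_smul]
  have hc0 : 0 ≤ c := (mul_self_nonneg _).trans hc
  have h1 : star a * a ≤ algebraMap ℝ A c := by
    rw [← CStarAlgebra.norm_le_iff_le_algebraMap _ hc0 (star_mul_self_nonneg a),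
      CStarRing.norm_star_mul_self]
    exact hc
  rw [e, CStarAlgebra.norm_le_iff_le_algebraMap _ hc0 (sub_nonneg.2 h1)]
  exact sub_le_self _ (star_mul_self_nonneg a)

/-- By the C*-identity, the left side is the norm of `h² + t²`, the cross terms cancelling. -/
theorem norm_add_I_smul_sq_le {h : A} (hh : IsSelfAdjoint h) (t : ℝ) :
    ‖h + (t * Complex.I : ℂ) • (1 : A)‖ ^ 2 ≤ ‖h‖ ^ 2 + t ^ 2 := by
  rcases subsingleton_or_nontrivial A with _ | _
  · rw [Subsingleton.elim (h + _) 0, norm_zero, zero_pow two_ne_zero]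
    exact add_nonneg (sq_nonneg _) (sq_nonneg _)
  have e : star (h + (t * Complex.I : ℂ) • (1 : A)) * (h + (t * Complex.I : ℂ) • (1 : A)) =
      h * h + ((t ^ 2 : ℝ) : ℂ) • (1 : A) := by
    have h1 : star ((t : ℂ) * Complex.I) = -(t * Complex.I) := by simp
    have h2 : ((t ^ 2 : ℝ) : ℂ) = -((t * Complex.I : ℂ) * (t * Complex.I)) := by
      rw [mul_mul_mul_comm, Complex.I_mul_I]
      push_cast
      ring
    rw [star_add, star_smul, star_one, hh.star_eq, h1, h2, add_mul, mul_add, smul_one_mul,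
      mul_smul_one]
    module
  rw [sq, ← CStarRing.norm_star_mul_self, e]
  refine (norm_add_le _ _).trans (add_le_add ?_ ?_)
  · rw [sq]; exact norm_mul_le _ _
  · rw [norm_smul, norm_one, mul_one, Complex.norm_real, Real.norm_of_nonneg (sq_nonneg t)]

/-- A contractive functional with value `1` at the unit is real on self-adjoint elements. -/
theorem im_apply_eq_zero_of_norm_le {φ : StrongDual ℂ A} (hφ : ‖φ‖ ≤ 1) (h1 : φ 1 = 1) {h : A}
    (hh : IsSelfAdjoint h) : (φ h).im = 0 := by
  by_contra hne
  -- The `t²` on both sides cancels, leaving a bound on an expression affine in `t`, which is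
  -- impossible for every real `t` when its slope is nonzero.
  have key : ∀ t : ℝ, (φ h).im ^ 2 + 2 * (φ h).im * t ≤ ‖h‖ ^ 2 := by
    intro t
    have b1 := φ.le_of_opNorm_le hφ (h + (t * Complex.I : ℂ) • (1 : A))
    rw [one_mul, map_add, map_smul, h1, smul_eq_mul, mul_one] at b1
    have b2 : ‖φ h + t * Complex.I‖ ^ 2 ≤ ‖h‖ ^ 2 + t ^ 2 :=
      (pow_le_pow_left₀ (norm_nonneg _) b1 2).trans (norm_add_I_smul_sq_le hh t)
    rw [← Complex.normSq_eq_norm_sq, Complex.normSq_apply] at b2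
    simp at b2
    nlinarith [mul_self_nonneg (φ h).re]
  have := key ((‖h‖ ^ 2 + 1) / (2 * (φ h).im))
  have e : 2 * (φ h).im * ((‖h‖ ^ 2 + 1) / (2 * (φ h).im)) = ‖h‖ ^ 2 + 1 := by
    field_simp
  rw [e] at this
  nlinarith [sq_nonneg (φ h).im]

/-- Since `‖a‖² - a*a` has norm at most `‖a‖²`, the real number `φ(a*a)` lies within `‖a‖²` of
`‖a‖²`, so it is nonnegative. -/
theorem isPositiveFunctional_of_norm_le {φ : StrongDual ℂ A} (hφ : ‖φ‖ ≤ 1) (h1 : φ 1 = 1) :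
    IsPositiveFunctional φ := by
  intro a
  rw [Complex.nonneg_iff]
  refine ⟨?_, (im_apply_eq_zero_of_norm_le hφ h1 (IsSelfAdjoint.star_mul_self a)).symm⟩
  have b := φ.le_of_opNorm_le hφ ((((‖a‖ * ‖a‖ : ℝ)) : ℂ) • (1 : A) - star a * a)
  rw [one_mul] at b
  have b' := b.trans (norm_smul_one_sub_le le_rfl)
  rw [map_sub, map_smul, h1, smul_eq_mul, mul_one] at b'
  have b2 := (Complex.re_le_norm _).trans b'
  rw [Complex.sub_re, Complex.ofReal_re] at b2
  linarith

theorem exists_star_mul_self_of_isSelfAdjoint {h : A} (hh : IsSelfAdjoint h) :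
    ∃ x : A, (‖h‖ : ℂ) • (1 : A) - h = star x * x := by
  let _ : PartialOrder A := CStarAlgebra.spectralOrder A
  have _ : StarOrderedRing A := CStarAlgebra.spectralOrderedRing A
  rw [← CStarAlgebra.nonneg_iff_eq_star_mul_self, sub_nonneg, Complex.coe_smul,
    ← Algebra.algebraMap_eq_smul_one]
  exact hh.le_algebraMap_norm_self

theorem IsPositiveFunctional.im_apply_eq_zero {φ : StrongDual ℂ A} (hφ : IsPositiveFunctional φ)
    {h : A} (hh : IsSelfAdjoint h) : (φ h).im = 0 := by
  obtain ⟨x, hx⟩ := exists_star_mul_self_of_isSelfAdjoint hh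
  have h1 := (Complex.nonneg_iff.1 (hφ x)).2
  have h2 := (Complex.nonneg_iff.1 (hφ 1)).2
  rw [star_one, one_mul] at h2
  rw [← hx, map_sub, map_smul, Complex.sub_im, smul_eq_mul, Complex.im_ofReal_mul, ← h2] at h1
  linarith

theorem IsPositiveFunctional.re_apply_le {φ : StrongDual ℂ A} (hφ : IsPositiveFunctional φ)
    {h : A} (hh : IsSelfAdjoint h) : (φ h).re ≤ (φ 1).re * ‖h‖ := by
  obtain ⟨x, hx⟩ := exists_star_mul_self_of_isSelfAdjoint hh
  have h1 := (Complex.nonneg_iff.1 (hφ x)).1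
  rw [← hx, map_sub, map_smul, Complex.sub_re, smul_eq_mul, Complex.re_ofReal_mul] at h1
  linarith

theorem IsPositiveFunctional.norm_apply_le {φ : StrongDual ℂ A} (hφ : IsPositiveFunctional φ)
    (a : A) : ‖φ a‖ ≤ (φ 1).re * ‖a‖ := by
  -- A phase turns `φ a` into its modulus, so only the self-adjoint real part of `c • a`
  -- contributes.
  obtain ⟨c, hc, hcφ⟩ : ∃ c : ℂ, ‖c‖ = 1 ∧ c * φ a = (‖φ a‖ : ℂ) := by
    by_cases h0 : φ a = 0
    · exact ⟨1, norm_one, by simp [h0]⟩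
    · refine ⟨‖φ a‖ / φ a, ?_, div_mul_cancel₀ _ h0⟩
      rw [norm_div, Complex.norm_real, norm_norm, div_self (norm_ne_zero_iff.2 h0)]
  have e := congrArg φ (realPart_add_I_smul_imaginaryPart (c • a))
  rw [map_add, map_smul φ Complex.I, map_smul φ c, smul_eq_mul c, hcφ] at e
  have e2 := congrArg Complex.re e
  rw [Complex.add_re, smul_eq_mul, Complex.I_mul_re, hφ.im_apply_eq_zero (imaginaryPart (c • a)).2,
    neg_zero, add_zero, Complex.ofReal_re] at e2
  rw [← e2]
  refine (hφ.re_apply_le (realPart (c • a)).2).trans ?_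
  have h0 : 0 ≤ (φ 1).re := by
    have := (Complex.nonneg_iff.1 (hφ 1)).1
    rwa [star_one, one_mul] at this
  refine mul_le_mul_of_nonneg_left ((realPart.norm_le (c • a)).trans_eq ?_) h0
  rw [norm_smul, hc, one_mul]

/-- Replaces positivity by a contractivity and normalisation condition that is visibly weak* closed,
convex and preserved by Hahn–Banach extension. -/
theorem mem_states_iff {φ : WeakDual ℂ A} :
    φ ∈ states A ↔ ‖toStrongDual φ‖ ≤ 1 ∧ φ 1 = 1 := by
  constructor
  · rintro ⟨hp, hn⟩
    have : Nontrivial A := by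
      by_contra hA
      rw [not_nontrivial_iff_subsingleton] at hA
      have : toStrongDual φ = 0 := ContinuousLinearMap.ext fun a => by
        rw [Subsingleton.elim a 0, map_zero, map_zero]
      rw [this, norm_zero] at hn
      exact zero_ne_one hn
    refine ⟨hn.le, Complex.ext ?_ (hp.im_apply_eq_zero (IsSelfAdjoint.one A))⟩
    apply le_antisymm
    · have := (toStrongDual φ).le_opNorm 1
      rw [hn, norm_one, one_mul] at this
      exact (Complex.re_le_norm _).trans this
    · have h0 : 0 ≤ (φ 1).re := by
        have := (Complex.nonneg_iff.1 (hp 1)).1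
        rwa [star_one, one_mul] at this
      exact hn.ge.trans ((toStrongDual φ).opNorm_le_bound h0 hp.norm_apply_le)
  · rintro ⟨hn, h1⟩
    refine ⟨isPositiveFunctional_of_norm_le hn h1, le_antisymm hn ?_⟩
    have : Nontrivial A := by
      refine ⟨1, 0, fun h => ?_⟩
      rw [h, map_zero] at h1
      exact zero_ne_one h1
    have := (toStrongDual φ).le_opNorm 1
    rw [norm_one, mul_one] at this
    refine le_trans ?_ this
    have e : toStrongDual φ 1 = 1 := h1
    rw [e, norm_one]

theorem apply_one_of_mem_states {φ : WeakDual ℂ A} (h : φ ∈ states A) : φ 1 = 1 :=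
  (mem_states_iff.1 h).2

theorem norm_apply_le_of_mem_states {φ : WeakDual ℂ A} (h : φ ∈ states A) (a : A) :
    ‖φ a‖ ≤ ‖a‖ :=
  ((toStrongDual φ).le_of_opNorm_le h.2.le a).trans_eq (one_mul _)

theorem isCompact_states : IsCompact (states A) := by
  have : states A = toStrongDual ⁻¹' Metric.closedBall (0 : StrongDual ℂ A) 1 ∩
      {φ | φ 1 = 1} := by
    ext φ
    rw [mem_states_iff, Set.mem_inter_iff, Set.mem_preimage, mem_closedBall_zero_iff]
    rfl
  rw [this]
  exact (WeakDual.isCompact_closedBall (0 : StrongDual ℂ A) 1).inter_right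
    (isClosed_eq (WeakDual.eval_continuous 1) continuous_const)

theorem convex_states : Convex ℝ (states A) := by
  intro φ hφ ψ hψ s t hs ht hst
  rw [mem_states_iff] at hφ hψ ⊢
  constructor
  · have : toStrongDual (s • φ + t • ψ) = s • toStrongDual φ + t • toStrongDual ψ := rfl
    rw [this]
    refine (norm_add_le _ _).trans ?_
    rw [norm_smul, norm_smul, Real.norm_of_nonneg hs, Real.norm_of_nonneg ht]
    nlinarith [hφ.1, hψ.1]
  · have : (s • φ + t • ψ) 1 = s • φ 1 + t • ψ 1 := rfl
    rw [this, hφ.2, hψ.2, ← add_smul, hst, one_smul]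

/-- A contractive functional on a subspace containing the unit, with value `1` at the unit,
extends to a state. -/
theorem exists_mem_states_extending (p : Submodule ℂ A) (h1 : (1 : A) ∈ p) (f : StrongDual ℂ p)
    (hf : ‖f‖ ≤ 1) (hf1 : f ⟨1, h1⟩ = 1) : ∃ φ ∈ states A, ∀ x : p, φ x = f x := by
  obtain ⟨g, hg, hgn⟩ := exists_extension_norm_eq p f
  exact ⟨StrongDual.toWeakDual g, mem_states_iff.2 ⟨hgn.trans_le hf, (hg ⟨1, h1⟩).trans hf1⟩, hg⟩

/-- In the commutative C*-algebra generated by `a` and `1`, a point of the spectrum of modulus `‖a‖`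
is the value of a character, and this character extends to a state. -/
theorem exists_mem_states_norm_eq [Nontrivial A] {a : A} (ha : IsSelfAdjoint a) :
    ∃ φ ∈ states A, ‖φ a‖ = ‖a‖ := by
  have : IsStarNormal a := ha.isStarNormal
  let E := StarAlgebra.elemental ℂ a
  let a' : E := ⟨a, StarAlgebra.elemental.self_mem ℂ a⟩
  have ha' : IsSelfAdjoint a' := Subtype.ext ha
  obtain ⟨k, hk, hkn⟩ := spectrum.exists_nnnorm_eq_spectralRadius a'
  rw [ha'.spectralRadius_eq_nnnorm] at hkn
  obtain ⟨χ, hχ⟩ := WeakDual.CharacterSpace.mem_spectrum_iff_exists.1 hk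
  obtain ⟨φ, hφ, hφχ⟩ := exists_mem_states_extending (Subalgebra.toSubmodule E.toSubalgebra)
    (one_mem E) (toStrongDual (χ : WeakDual ℂ E)) (CharacterSpace.norm_le_norm_one χ |>.trans
      norm_one.le) (map_one χ)
  refine ⟨φ, hφ, ?_⟩
  have e : φ a = χ a' := hφχ a'
  rw [e, hχ]
  exact congrArg NNReal.toReal (ENNReal.coe_injective hkn)

end Unital

/-! ### Characters and units of commutative C*-subalgebras -/

section Characters
variable {A : Type*} [NonUnitalCStarAlgebra A]

theorem norm_character_apply_le (χ : characterSpace ℂ A) (a : A) : ‖χ a‖ ≤ ‖a‖ :=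
  NonUnitalStarAlgHom.norm_apply_le
    ({ CharacterSpace.toNonUnitalAlgHom χ with map_star' := character_star χ } : A →⋆ₙₐ[ℂ] ℂ) a

theorem norm_character_le (χ : characterSpace ℂ A) : ‖toStrongDual (χ : WeakDual ℂ A)‖ ≤ 1 :=
  (toStrongDual (χ : WeakDual ℂ A)).opNorm_le_bound zero_le_one fun a => by
    rw [one_mul]; exact norm_character_apply_le χ a

/-- Characters together with `0` form a closed part of the dual unit ball; the closed condition `φ e
= 1` removes `0` and no character. -/
theorem isCompact_characterSpace_of_unit {e : A} (he : ∀ a : A, e * a = a) :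
    IsCompact (Set.univ : Set (characterSpace ℂ A)) := by
  rw [← isCompact_iff_isCompact_univ]
  have : characterSpace ℂ A = (toStrongDual ⁻¹' Metric.closedBall (0 : StrongDual ℂ A) 1 ∩
      (characterSpace ℂ A ∪ {0})) ∩ {φ | φ e = 1} := by
    ext φ
    constructor
    · intro h
      refine ⟨⟨mem_closedBall_zero_iff.2 (norm_character_le ⟨φ, h⟩), Or.inl h⟩, ?_⟩
      obtain ⟨a, ha⟩ : ∃ a, φ a ≠ 0 := by
        by_contra! h'
        exact h.1 (ContinuousLinearMap.ext h')
      have e1 := h.2 e a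
      rw [he] at e1
      exact (mul_right_cancel₀ ha (e1.symm.trans (one_mul _).symm) : φ e = 1)
    · rintro ⟨⟨-, h | h⟩, h1⟩
      · exact h
      · rw [Set.mem_singleton_iff] at h
        have h2 : φ e = 1 := h1
        rw [h] at h2
        exact absurd h2 zero_ne_one
  rw [this]
  exact (((WeakDual.isCompact_closedBall (0 : StrongDual ℂ A) 1).inter_right
    (CharacterSpace.union_zero_isClosed ℂ A))).inter_right
    (isClosed_eq (WeakDual.eval_continuous e) continuous_const)

end Characters

/-- A character of the unitization restricts to `M` either as a character or as `0`. The unital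
Gelfand transform is injective. -/
theorem eq_zero_of_character_apply_eq_zero {M : Type*} [NonUnitalCommCStarAlgebra M] {n : M}
    (h : ∀ χ : characterSpace ℂ M, χ n = 0) : n = 0 := by
  have key : ∀ ψ : characterSpace ℂ (Unitization ℂ M), ψ (n : Unitization ℂ M) = 0 := by
    intro ψ
    let φ : WeakDual ℂ M := StrongDual.toWeakDual
      ((toStrongDual (ψ : WeakDual ℂ (Unitization ℂ M))).comp
        (⟨(Unitization.inrNonUnitalAlgHom ℂ M : M →ₗ[ℂ] Unitization ℂ M),
          (Unitization.isometry_inr (𝕜 := ℂ) (A := M)).continuous⟩ :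
          M →L[ℂ] Unitization ℂ M))
    have hφ : ∀ a, φ a = ψ (a : Unitization ℂ M) := fun a => rfl
    by_cases h0 : φ = 0
    · rw [← hφ, h0]; rfl
    · have := h ⟨φ, h0, fun a b => by rw [hφ, hφ, hφ, Unitization.inr_mul, map_mul]⟩
      exact this
  have h1 : (n : Unitization ℂ M) = 0 := by
    apply (gelfandTransform_isometry (Unitization ℂ M)).injective
    rw [map_zero]
    ext ψ
    exact key ψ
  exact Unitization.inr_injective (h1.trans (Unitization.inr_zero ℂ).symm)

section Subalgebra
variable {A : Type*} [NonUnitalCStarAlgebra A] {M : NonUnitalStarSubalgebra ℂ A}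

theorem eq_of_character_apply_eq (hM : IsClosed (M : Set A))
    (hcomm : ∀ x ∈ M, ∀ y ∈ M, x * y = y * x) {m n : M}
    (h : ∀ χ : characterSpace ℂ M, χ m = χ n) : m = n := by
  have : IsClosed (M : Set A) := hM
  let _ : NonUnitalCommCStarAlgebra M :=
    { (inferInstance : NonUnitalCStarAlgebra M) with
      mul_comm := fun x y => Subtype.ext (hcomm x x.2 y y.2) }
  rw [← sub_eq_zero]
  refine eq_zero_of_character_apply_eq_zero fun χ => ?_
  rw [map_sub, sub_eq_zero]
  exact h χ

/-- A cutoff function equal to `1` on the whole spectrum is a unit, because characters separate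
points. -/
theorem exists_unit_of_isCompact (hM : IsClosed (M : Set A))
    (hcomm : ∀ x ∈ M, ∀ y ∈ M, x * y = y * x)
    (hK : IsCompact (Set.univ : Set (characterSpace ℂ M))) :
    ∃ e ∈ M, ∀ m ∈ M, e * m = m ∧ m * e = m := by
  have : IsClosed (M : Set A) := hM
  obtain ⟨m, -, hm⟩ := character_eventually_one _ hK
  refine ⟨_, (star m * m).2, fun n hn => ?_⟩
  have h1 : star m * m * (⟨n, hn⟩ : M) = ⟨n, hn⟩ := eq_of_character_apply_eq hM hcomm fun χ => by
    rw [map_mul, hm χ (Set.mem_univ χ), one_mul]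
  have h2 := congrArg Subtype.val h1
  exact ⟨h2, (hcomm _ hn _ (star m * m).2).trans h2⟩

theorem IsTopography.hasUnit (hM : IsTopography M)
    (hK : IsCompact (Set.univ : Set (characterSpace ℂ M))) : HasUnit A := by
  obtain ⟨e, -, he⟩ := exists_unit_of_isCompact hM.isClosed hM.comm hK
  obtain ⟨l, hl, hlM⟩ := hM.approxUnit
  have := hl.neBot
  refine ⟨e, fun a => ⟨?_, ?_⟩⟩
  · refine tendsto_nhds_unique ?_ (hl.tendsto_mul_right a)
    refine Tendsto.congr' ?_ ((hl.tendsto_mul_right a).const_mul e)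
    filter_upwards [hlM] with x hx
    rw [← mul_assoc, (he x hx).1]
  · refine tendsto_nhds_unique ?_ (hl.tendsto_mul_left a)
    refine Tendsto.congr' ?_ ((hl.tendsto_mul_left a).mul_const e)
    filter_upwards [hlM] with x hx
    rw [mul_assoc, (he x hx).2]

end Subalgebra

/-- Urysohn's lemma on the compact Hausdorff spectrum, transported to `N` by the Gelfand
isomorphism. -/
theorem exists_cutoff_vanishing_of_hasUnit {N : Type*} [NonUnitalCStarAlgebra N] (h1 : HasUnit N)
    (hc : ∀ x y : N, x * y = y * x) {K : Set (characterSpace ℂ N)} (hK : IsCompact K)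
    {χ : characterSpace ℂ N} (hχ : χ ∉ K) :
    ∃ m : N, ‖m‖ ≤ 1 ∧ (∀ ψ ∈ K, ψ (star m * m) = 1) ∧ χ m = 0 := by
  obtain ⟨_, rfl⟩ := h1.exists_cstarAlgebra
  let _ : CommCStarAlgebra N := { ‹CStarAlgebra N› with mul_comm := hc }
  obtain ⟨f, hf0, hf1, hf⟩ := exists_continuous_zero_one_of_isClosed
    (isClosed_singleton (x := χ)) hK.isClosed (Set.disjoint_singleton_left.2 hχ)
  let g : C(characterSpace ℂ N, ℂ) := ⟨fun ψ => (f ψ : ℂ), by fun_prop⟩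
  obtain ⟨m, hm⟩ := (gelfandTransform_bijective N).2 g
  have hmψ : ∀ ψ : characterSpace ℂ N, ψ m = (f ψ : ℂ) := fun ψ => DFunLike.congr_fun hm ψ
  refine ⟨m, ?_, fun ψ hψ => ?_, ?_⟩
  · rw [← (gelfandTransform_isometry N).norm_map_of_map_zero (map_zero _), hm,
      ContinuousMap.norm_le _ zero_le_one]
    intro ψ
    rw [ContinuousMap.coe_mk, Complex.norm_real, Real.norm_of_nonneg (hf ψ).1]
    exact (hf ψ).2
  · rw [map_mul, character_star, hmψ, hf1 hψ]
    simp
  · rw [hmψ, hf0 rfl]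
    simp

/-! ### Topographies of unital algebras and the indicator of the whole spectrum -/

section Unital
variable {A : Type*} [CStarAlgebra A] {M : NonUnitalStarSubalgebra ℂ A}

theorem tendsto_one_of_isApproximateUnit {l : Filter A} (hl : l.IsApproximateUnit) :
    Tendsto id l (𝓝 1) := by
  simpa [Function.id_def] using hl.tendsto_mul_left 1

theorem IsTopography.one_mem (hM : IsTopography M) : (1 : A) ∈ M := by
  obtain ⟨l, hl, hlM⟩ := hM.approxUnit
  have := hl.neBot
  exact hM.isClosed.mem_of_tendsto (tendsto_one_of_isApproximateUnit hl) hlM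

theorem IsTopography.isCompact_univ (hM : IsTopography M) :
    IsCompact (Set.univ : Set (characterSpace ℂ M)) := by
  have : IsClosed (M : Set A) := hM.isClosed
  exact isCompact_characterSpace_of_unit (e := (⟨1, hM.one_mem⟩ : M))
    fun a => Subtype.ext (one_mul (a : A))

theorem character_one (h1 : (1 : A) ∈ M) (χ : characterSpace ℂ M) : χ ⟨1, h1⟩ = 1 := by
  obtain ⟨a, ha⟩ : ∃ a, χ a ≠ 0 := by
    by_contra! h'
    exact χ.2.1 (ContinuousLinearMap.ext h')
  have e1 := χ.2.2 ⟨1, h1⟩ a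
  have e2 : (⟨1, h1⟩ : M) * a = a := Subtype.ext (one_mul (a : A))
  rw [e2] at e1
  exact mul_right_cancel₀ ha (e1.symm.trans (one_mul _).symm)

/-- Characters of a unital C*-subalgebra extend to states. -/
theorem exists_mem_states_extending_character (hM : IsClosed (M : Set A)) (h1 : (1 : A) ∈ M)
    (χ : characterSpace ℂ M) : ∃ φ ∈ states A, ∀ m : M, φ m = χ m := by
  have : IsClosed (M : Set A) := hM
  exact exists_mem_states_extending M.toNonUnitalSubalgebra.toSubmodule h1
    (toStrongDual (χ : WeakDual ℂ M)) (norm_character_le χ) (character_one h1 χ)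

theorem IsTopography.cutoffs_univ (hM : IsTopography M) : cutoffs M Set.univ = {1} := by
  have : IsClosed (M : Set A) := hM.isClosed
  ext f
  constructor
  · rintro ⟨m, rfl, -, hm⟩
    have : star m * m = ⟨1, hM.one_mem⟩ := eq_of_character_apply_eq hM.isClosed hM.comm fun χ => by
      rw [hm χ (Set.mem_univ χ), character_one]
    exact congrArg Subtype.val this
  · rintro rfl
    obtain ⟨m, hm, hmK⟩ := character_eventually_one _ hM.isCompact_univ
    refine ⟨m, ?_, hm, hmK⟩
    have : star m * m = ⟨1, hM.one_mem⟩ := eq_of_character_apply_eq hM.isClosed hM.comm fun χ => by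
      rw [hmK χ (Set.mem_univ χ), character_one]
    exact (congrArg Subtype.val this).symm

theorem IsTopography.indicator_univ (hM : IsTopography M) :
    indicator M Set.univ = toBidual (1 : A) := by
  refine IsIndicator.unique hM.isClosed hM.comm hM.isCompact_univ
    (isIndicator_indicator M hM.isClosed hM.comm _ hM.isCompact_univ) fun φ => ?_
  have : cutoffFilter M Set.univ ≤ 𝓟 {(1 : A)} := by
    rw [cutoffFilter, hM.cutoffs_univ]
    refine iInf₂_le_of_le (1 : A) rfl (principal_mono.2 ?_)
    exact fun h hh => hh.1
  refine Tendsto.mono_left ?_ this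
  rw [principal_singleton]
  exact tendsto_pure_nhds φ 1

theorem IsTopography.corner_univ (hM : IsTopography M) (a : A) :
    corner M Set.univ a = toBidual a := by
  rw [corner, hM.indicator_univ, arensMul_toBidual, arensMul_toBidual, mul_one, one_mul]

theorem IsTopography.statesOn_univ (hM : IsTopography M) : statesOn M Set.univ = states A := by
  ext φ
  refine ⟨fun h => h.1, fun h => ⟨h, ?_⟩⟩
  rw [hM.indicator_univ]
  exact apply_one_of_mem_states h

/-- A cutoff function of a compact set vanishing at a given point outside. -/
theorem IsTopography.exists_cutoff_vanishing (hM : IsTopography M)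
    {K : Set (characterSpace ℂ M)} (hK : IsCompact K) {χ : characterSpace ℂ M} (hχ : χ ∉ K) :
    ∃ m : M, ‖m‖ ≤ 1 ∧ (∀ ψ ∈ K, ψ (star m * m) = 1) ∧ χ m = 0 := by
  have : IsClosed (M : Set A) := hM.isClosed
  exact exists_cutoff_vanishing_of_hasUnit
    ⟨⟨1, hM.one_mem⟩, fun a => ⟨Subtype.ext (one_mul (a : A)), Subtype.ext (mul_one (a : A))⟩⟩
    (fun x y => Subtype.ext (hM.comm x x.2 y y.2)) hK hχ

/-- If `1_K` is the unit then `K` is the whole spectrum. -/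
theorem IsTopography.eq_univ_of_arensMul_indicator (hM : IsTopography M)
    {K : Set (characterSpace ℂ M)} (hK : IsCompact K)
    (h : arensMul (indicator M K) (indicator M K) = toBidual (1 : A)) : K = Set.univ := by
  by_contra hne
  obtain ⟨χ, hχ⟩ := (Set.ne_univ_iff_exists_notMem K).1 hne
  obtain ⟨m, hm, hmK, hmχ⟩ := hM.exists_cutoff_vanishing hK hχ
  -- Elements of the bidual are tested against functionals on all of `A`, so the point `χ` outside
  -- `K` is represented by a state extending it.
  obtain ⟨φ, hφ, hφχ⟩ := exists_mem_states_extending_character hM.isClosed hM.one_mem χ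
  have hp := isIndicator_indicator M hM.isClosed hM.comm K hK
  have := (exists_isIndicator M hM.isClosed hM.comm K hK).1
  have hf : ((star m * m : M) : A) ∈ cutoffs M K := ⟨m, rfl, hm, hmK⟩
  have hmem : ({h | h ∈ cutoffs M K ∧ ∃ x : A, ((star m * m : M) : A) - h = star x * x} : Set A) ∈
      cutoffFilter M K := mem_iInf_of_mem _ (mem_iInf_of_mem hf (mem_principal_self _))
  -- Positivity of `φ` squeezes a cutoff below `star m * m` between `0` and `φ (star m * m) = 0`.
  have hzero : ∀ᶠ x : A in cutoffFilter M K, ∃ n : M, x = n ∧ χ n = 0 := by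
    filter_upwards [hmem]
    rintro _ ⟨⟨n, rfl, -, -⟩, x, hx⟩
    refine ⟨star n * n, rfl, ?_⟩
    have h1 : 0 ≤ φ (star (n : A) * n) := hφ.1 n
    have h2 : 0 ≤ φ (star x * x) := hφ.1 x
    have h3 : φ ((star m * m : M) : A) = 0 := by rw [hφχ, map_mul, hmχ, mul_zero]
    rw [← hx, map_sub, h3, zero_sub] at h2
    rw [← hφχ]
    exact le_antisymm (neg_nonneg.1 h2) h1
  -- The Arens product is an iterated limit of `φ (n * n') = χ n * χ n'`, which is eventually `0` in
  -- each variable. The unit would instead give `φ 1 = 1`.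
  have h1 : arensMul (indicator M K) (indicator M K) (toStrongDual φ) = 0 := by
    rw [arensMul_apply]
    refine tendsto_nhds_unique (hp _) ((tendsto_congr' ?_).2 tendsto_const_nhds)
    filter_upwards [hzero]
    rintro _ ⟨n, rfl, hn⟩
    refine tendsto_nhds_unique (hp ((ContinuousLinearMap.compL ℂ A A ℂ (toStrongDual φ))
      (ContinuousLinearMap.mul ℂ A (n : A)))) ((tendsto_congr' ?_).2 tendsto_const_nhds)
    filter_upwards [hzero]
    rintro _ ⟨n', rfl, hn'⟩
    have : φ ((n * n' : M) : A) = 0 := by rw [hφχ, map_mul, hn', mul_zero]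
    exact this
  rw [h] at h1
  exact one_ne_zero ((apply_one_of_mem_states hφ).symm.trans h1)

end Unital

/-! ### Closed ranges of *-morphisms -/

section Range
variable {D A : Type*} [NonUnitalCStarAlgebra D] [NonUnitalCStarAlgebra A]

theorem continuous_starAlgHom (π : D →⋆ₙₐ[ℂ] A) : Continuous π :=
  AddMonoidHomClass.continuous_of_bound π 1 fun d => by
    rw [one_mul]; exact NonUnitalStarAlgHom.norm_apply_le π d

theorem exists_isSelfAdjoint_lift (π : D →⋆ₙₐ[ℂ] A) {d : D} (h : IsSelfAdjoint (π d)) :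
    ∃ d', IsSelfAdjoint d' ∧ π d' = π d := by
  refine ⟨(realPart d : D), (realPart d).2, ?_⟩
  rw [realPart_apply_coe, ← Complex.coe_smul, map_smul, map_add, map_star, h.star_eq,
    Complex.coe_smul, ← two_smul ℝ, smul_smul, inv_mul_cancel₀ two_ne_zero, one_smul]

/-- Clamping a self-adjoint lift to `[-‖π d‖, ‖π d‖]` by functional calculus leaves its image
unchanged, as the clamp is the identity on the spectrum of the image. -/
theorem exists_lift_norm_le (π : D →⋆ₙₐ[ℂ] A) {d : D} (h : IsSelfAdjoint (π d)) :
    ∃ d', π d' = π d ∧ ‖d'‖ ≤ ‖π d‖ := by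
  obtain ⟨d₁, hd₁, e⟩ := exists_isSelfAdjoint_lift π h
  rw [← e] at h ⊢
  let f : ℝ → ℝ := fun x => max (-‖π d₁‖) (min x ‖π d₁‖)
  have hf : Continuous f := by fun_prop
  have hf0 : f 0 = 0 := by simp [f]
  refine ⟨cfcₙ f d₁, ?_, norm_cfcₙ_le fun x _ => ?_⟩
  · rw [π.map_cfcₙ f d₁ hf.continuousOn hf0 (continuous_starAlgHom π) hd₁ h]
    conv_rhs => rw [← cfcₙ_id ℝ (π d₁) h]
    refine cfcₙ_congr fun x hx => ?_
    have := abs_le.1 (NonUnitalIsometricContinuousFunctionalCalculus.norm_quasispectrum_le _ hx h)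
    simp only [f, id]
    rw [min_eq_left this.2, max_eq_right this.1]
  · rw [Real.norm_eq_abs, abs_le]
    exact ⟨le_max_left _ _, max_le (neg_le_self (norm_nonneg _)) (min_le_right _ _)⟩

theorem surjective_of_dense (π : D →⋆ₙₐ[ℂ] A)
    (h : ∀ a, IsSelfAdjoint a → a ∈ closure (Set.range π)) : Function.Surjective π := by
  let f : NormedAddGroupHom D A :=
    { toFun := π
      map_add' := map_add π
      bound' := ⟨1, fun d => by rw [one_mul]; exact NonUnitalStarAlgHom.norm_apply_le π d⟩ }
  have hf : ∀ d, f d = π d := fun d => rfl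
  let K : AddSubgroup A := (π : D →+ A).range
  have hK : (K : Set A) = Set.range π := rfl
  -- The constant `2` comes from lifting real and imaginary parts separately. Bounded lifting on the
  -- range passes to its closure by summing a series of corrections in the complete algebra `D`.
  have h1 : f.SurjectiveOnWith K 2 := by
    rintro _ ⟨d, rfl⟩
    have e1 : π (realPart d : D) = realPart (π d) := by
      rw [realPart_apply_coe, realPart_apply_coe, ← Complex.coe_smul, map_smul, map_add, map_star,
        Complex.coe_smul]
    have e2 : π (imaginaryPart d : D) = imaginaryPart (π d) := by
      rw [imaginaryPart_apply_coe, imaginaryPart_apply_coe, map_smul, ← Complex.coe_smul, map_smul,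
        map_sub, map_star, Complex.coe_smul]
    obtain ⟨x, hx, hxn⟩ := exists_lift_norm_le π (d := (realPart d : D))
      (by rw [e1]; exact (realPart (π d)).2)
    obtain ⟨y, hy, hyn⟩ := exists_lift_norm_le π (d := (imaginaryPart d : D))
      (by rw [e2]; exact (imaginaryPart (π d)).2)
    rw [e1] at hx hxn
    rw [e2] at hy hyn
    refine ⟨x + Complex.I • y, ?_, ?_⟩
    · rw [hf, map_add, map_smul, hx, hy]
      exact realPart_add_I_smul_imaginaryPart (π d)
    · refine (norm_add_le _ _).trans ?_
      rw [norm_smul, Complex.norm_I, one_mul, two_mul]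
      exact add_le_add (hxn.trans (realPart.norm_le (π d)))
        (hyn.trans (imaginaryPart.norm_le (π d)))
  have h2 := controlled_closure_of_complete two_pos one_pos h1
  have h3 : ∀ a, IsSelfAdjoint a → ∃ d, π d = a := fun a ha => by
    obtain ⟨g, hg, -⟩ := h2 a (h a ha)
    exact ⟨g, hg⟩
  intro a
  obtain ⟨x, hx⟩ := h3 _ (realPart a).2
  obtain ⟨y, hy⟩ := h3 _ (imaginaryPart a).2
  exact ⟨x + Complex.I • y, by
    rw [map_add, map_smul, hx, hy]; exact realPart_add_I_smul_imaginaryPart a⟩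

theorem IsQuotientLip.exists_lift {LD : D → ℝ≥0∞} {LA : A → ℝ≥0∞} {π : D →⋆ₙₐ[ℂ] A}
    (h : IsQuotientLip LD LA π) {a : A} (ha : IsSelfAdjoint a) {c : ℝ≥0∞} (hc : LA a < c) :
    ∃ d, IsSelfAdjoint d ∧ π d = a ∧ LD d < c := by
  rw [h a ha] at hc
  simp only [iInf_lt_iff] at hc
  obtain ⟨d, ⟨hd, hda⟩, hlt⟩ := hc
  exact ⟨d, hd, hda, hlt⟩

theorem IsQuotientLip.apply_le {LD : D → ℝ≥0∞} {LA : A → ℝ≥0∞} {π : D →⋆ₙₐ[ℂ] A}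
    (h : IsQuotientLip LD LA π) {d : D} (hd : IsSelfAdjoint d) : LA (π d) ≤ LD d := by
  rw [h _ (hd.map π)]
  exact iInf₂_le d ⟨hd, rfl⟩

theorem IsQuotientLip.surjective {LD : D → ℝ≥0∞} {LA : A → ℝ≥0∞} {π : D →⋆ₙₐ[ℂ] A}
    (h : IsQuotientLip LD LA π) (hA : IsLipschitzPair LA) : Function.Surjective π := by
  refine surjective_of_dense π fun a ha => closure_mono ?_ (hA.dense a ha)
  intro b hb
  obtain ⟨d, -, hd, -⟩ := h.exists_lift (hA.isSelfAdjoint b hb) (lt_top_iff_ne_top.2 hb)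
  exact ⟨d, hd⟩

end Range

/-! ### Lipschitz pairs -/

section Lipschitz
variable {A : Type*} [NonUnitalCStarAlgebra A] {L : A → ℝ≥0∞}

/-- Normalising by a positive upper bound instead of by `L a` avoids dividing by zero when `L a =
0`. -/
theorem IsLipschitzPair.apply_inv_smul_le (h : IsLipschitzPair L) {a : A} {c : ℝ} (hc : 0 < c)
    (ha : L a ≤ ENNReal.ofReal c) : L (((c⁻¹ : ℝ) : ℂ) • a) ≤ 1 := by
  rw [h.smul _ _ (ne_top_of_le_ne_top ENNReal.ofReal_ne_top ha), abs_of_pos (inv_pos.2 hc)]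
  refine (mul_le_mul_right ha _).trans_eq ?_
  rw [← ENNReal.ofReal_mul (inv_pos.2 hc).le, inv_mul_cancel₀ hc.ne', ENNReal.ofReal_one]

theorem isSelfAdjoint_ofReal_smul {A : Type*} [NonUnitalCStarAlgebra A] {a : A}
    (ha : IsSelfAdjoint a) (c : ℝ) : IsSelfAdjoint ((c : ℂ) • a) := by
  rw [IsSelfAdjoint, star_smul, ha.star_eq]
  simp

theorem norm_sub_le_of_inv_smul {z w : ℂ} {c s : ℝ} (hc : 0 < c)
    (h : ‖((c⁻¹ : ℝ) : ℂ) * z - ((c⁻¹ : ℝ) : ℂ) * w‖ₑ ≤ ENNReal.ofReal s) (hs : 0 ≤ s) :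
    ‖z - w‖ ≤ c * s := by
  rw [← mul_sub, enorm_mul, ← ofReal_norm, ← ofReal_norm, ← ENNReal.ofReal_mul (norm_nonneg _),
    ENNReal.ofReal_le_ofReal_iff hs, Complex.norm_real, Real.norm_of_nonneg (inv_pos.2 hc).le,
    inv_mul_le_iff₀ hc] at h
  exact h

theorem IsLipschitzPair.norm_sub_le (h : IsLipschitzPair L) {a : A} {c : ℝ} (hc : 0 < c)
    (hsa : IsSelfAdjoint a) (ha : L a ≤ ENNReal.ofReal c) {φ ψ : WeakDual ℂ A} {s : ℝ}
    (hs : 0 ≤ s) (hk : kantorovich L φ ψ ≤ ENNReal.ofReal s) : ‖φ a - ψ a‖ ≤ c * s := by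
  refine norm_sub_le_of_inv_smul hc (le_trans ?_ hk) hs
  have := le_iSup₂ (f := fun (a : A) (_ : IsSelfAdjoint a ∧ L a ≤ 1) => ‖φ a - ψ a‖ₑ)
    (((c⁻¹ : ℝ) : ℂ) • a) ⟨isSelfAdjoint_ofReal_smul hsa _, h.apply_inv_smul_le hc ha⟩
  simp only [map_smul, smul_eq_mul] at this
  exact this

theorem IsLipschitzPair.norm_character_sub_le (h : IsLipschitzPair L)
    {M : NonUnitalStarSubalgebra ℂ A} {m : M} {c : ℝ} (hc : 0 < c)
    (hsa : IsSelfAdjoint (m : A)) (ha : L m ≤ ENNReal.ofReal c) {φ ψ : characterSpace ℂ M} {s : ℝ}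
    (hs : 0 ≤ s) (hk : specKantorovich L M φ ψ ≤ ENNReal.ofReal s) : ‖φ m - ψ m‖ ≤ c * s := by
  refine norm_sub_le_of_inv_smul hc (le_trans ?_ hk) hs
  have := le_iSup₂ (f := fun (a : M) (_ : IsSelfAdjoint a ∧ L a ≤ 1) => ‖φ a - ψ a‖ₑ)
    (((c⁻¹ : ℝ) : ℂ) • m) ⟨Subtype.ext (isSelfAdjoint_ofReal_smul hsa _),
      h.apply_inv_smul_le hc ha⟩
  simp only [map_smul, smul_eq_mul] at this
  exact this

theorem IsLipschitzPair.apply_one {A : Type*} [CStarAlgebra A] {L : A → ℝ≥0∞}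
    (h : IsLipschitzPair L) : L 1 = 0 :=
  (h.eq_zero_iff 1).2 ⟨IsSelfAdjoint.one A, 1, fun b => by simp⟩

theorem IsLipschitzPair.apply_real_smul_one {A : Type*} [CStarAlgebra A] {L : A → ℝ≥0∞}
    (h : IsLipschitzPair L) (t : ℝ) : L ((t : ℂ) • (1 : A)) = 0 := by
  rw [h.smul t 1 (by rw [h.apply_one]; exact ENNReal.zero_ne_top), h.apply_one, mul_zero]

theorem LeibnizOn.of_finite {A : Type*} [NonUnitalCStarAlgebra A] {L : A → ℝ≥0∞}
    (hL : IsLipschitzPair L) (h : LeibnizOn L {a | IsSelfAdjoint a ∧ L a < ⊤}) :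
    LeibnizOn L {a | IsSelfAdjoint a} := by
  have h0 : L 0 = 0 := (hL.eq_zero_iff 0).2 ⟨IsSelfAdjoint.zero A, 0, fun b => by simp⟩
  intro a ha b hb
  -- Since `0 * ∞ = 0` in `ℝ≥0∞`, an infinite Lip-norm makes the right side infinite only when the
  -- other factor is nonzero.
  by_cases hz : a = 0 ∨ b = 0
  · have e1 : jordan a b = 0 := by rcases hz with rfl | rfl <;> simp [jordan]
    have e2 : lie a b = 0 := by rcases hz with rfl | rfl <;> simp [lie]
    rw [e1, e2, h0]
    exact ⟨zero_le, zero_le⟩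
  rw [not_or] at hz
  by_cases hat : L a = ⊤
  · rw [hat, ENNReal.top_mul (enorm_ne_zero.2 hz.2), add_top]
    exact ⟨le_top, le_top⟩
  by_cases hbt : L b = ⊤
  · rw [hbt, ENNReal.mul_top (enorm_ne_zero.2 hz.1), top_add]
    exact ⟨le_top, le_top⟩
  exact h a ⟨ha, lt_top_iff_ne_top.2 hat⟩ b ⟨hb, lt_top_iff_ne_top.2 hbt⟩

end Lipschitz

/-! ### Compact spectra -/

/-- Evaluation at a Lipschitz element is Lipschitz for the metric. Characters are contractive, so
evaluation at any self-adjoint element of `M` is a uniform limit of such functions. -/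
theorem IsProperQMS.continuous_ballTopology {A : Type*} [NonUnitalCStarAlgebra A] {L : A → ℝ≥0∞}
    {M : NonUnitalStarSubalgebra ℂ A} (h : IsProperQMS L M) :
    @Continuous _ _ (ballTopology (specKantorovich L M)) _
      (id : characterSpace ℂ M → characterSpace ℂ M) := by
  have hL := h.leibniz.1
  have : IsClosed (M : Set A) := h.qlcms.topography.isClosed
  let t : TopologicalSpace (characterSpace ℂ M) := ballTopology (specKantorovich L M)
  have hsa : ∀ m : M, IsSelfAdjoint (m : A) →
      @Continuous _ _ t _ fun χ : characterSpace ℂ M => χ m := by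
    intro m hm
    rw [@continuous_iff_continuousAt _ _ t]
    intro χ
    rw [ContinuousAt, Metric.tendsto_nhds]
    intro ε hε
    obtain ⟨n, ⟨⟨K, -, hnsa, -, hn⟩, hnM⟩, hmn⟩ :=
      Metric.mem_closure_iff.1 (h.dense_topography ⟨m.2, hm⟩) (ε / 4) (by positivity)
    obtain ⟨c, hc, hnc⟩ : ∃ c : ℝ, 0 < c ∧ L n ≤ ENNReal.ofReal c :=
      ⟨(L n).toReal + 1, by positivity, (ENNReal.le_ofReal_iff_toReal_le hn.ne (by positivity)).2
        (le_add_of_nonneg_right zero_le_one)⟩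
    have hopen : IsOpen[t] {ψ | specKantorovich L M ψ χ < ENNReal.ofReal (ε / 4 / c)} :=
      TopologicalSpace.isOpen_generateFrom_of_mem ⟨χ, _, rfl⟩
    have hmem : χ ∈ {ψ | specKantorovich L M ψ χ < ENNReal.ofReal (ε / 4 / c)} := by
      have : specKantorovich L M χ χ = 0 := by simp [specKantorovich, subKantorovich]
      rw [Set.mem_ofPred_eq, this]
      exact ENNReal.ofReal_pos.2 (by positivity)
    filter_upwards [hopen.mem_nhds hmem] with ψ hψ
    have b1 := hL.norm_character_sub_le (m := ⟨n, hnM⟩) hc hnsa hnc (by positivity) hψ.le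
    have b2 : c * (ε / 4 / c) = ε / 4 := by field_simp
    have b3 : ∀ ψ : characterSpace ℂ M, ‖ψ m - ψ ⟨n, hnM⟩‖ ≤ ε / 4 := fun ψ => by
      rw [← map_sub]
      refine (norm_character_apply_le ψ _).trans ?_
      rw [dist_eq_norm] at hmn
      exact hmn.le
    have b4 := b3 ψ
    have b5 := b3 χ
    rw [b2] at b1
    rw [← dist_eq_norm] at b1 b4 b5
    have := dist_triangle4 (ψ m) (ψ ⟨n, hnM⟩) (χ ⟨n, hnM⟩) (χ m)
    rw [dist_comm (χ ⟨n, hnM⟩)] at this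
    linarith
  refine @Continuous.subtype_mk _ _ _ t _ _ ?_ _
  refine WeakDual.continuous_of_continuous_eval fun m => ?_
  have e : (fun χ : characterSpace ℂ M => (χ : WeakDual ℂ M) m) = fun χ : characterSpace ℂ M =>
      χ (realPart m : M) + Complex.I * χ (imaginaryPart m : M) := by
    funext χ
    rw [← smul_eq_mul, ← map_smul, ← map_add, realPart_add_I_smul_imaginaryPart]
    rfl
  refine e ▸ ?_
  exact (hsa _ (congrArg Subtype.val (realPart m).2)).add
    (continuous_const.mul (hsa _ (congrArg Subtype.val (imaginaryPart m).2)))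

theorem specBall_eq_univ {A : Type*} [NonUnitalCStarAlgebra A] {L : A → ℝ≥0∞}
    {M : NonUnitalStarSubalgebra ℂ A} (χ : characterSpace ℂ M) {r : ℝ}
    (hr : specDiam L M ≤ ENNReal.ofReal r) : specBall L M χ r = Set.univ :=
  Set.eq_univ_of_forall fun ψ => (le_iSup₂ (f := specKantorovich L M) ψ χ).trans hr

theorem IsProperQMS.isCompact_univ {A : Type*} [NonUnitalCStarAlgebra A] {L : A → ℝ≥0∞}
    {M : NonUnitalStarSubalgebra ℂ A} (h : IsProperQMS L M) {χ : characterSpace ℂ M} {r : ℝ}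
    (hr : specBall L M χ r = Set.univ) : IsCompact (Set.univ : Set (characterSpace ℂ M)) := by
  have h1 := h.proper χ r
  rw [hr] at h1
  have h2 := @IsCompact.image _ _ (ballTopology (specKantorovich L M)) _ _ _ h1
    h.continuous_ballTopology
  rwa [Set.image_id] at h2

section Unital
variable {A : Type*} [CStarAlgebra A] {L : A → ℝ≥0∞} {M : NonUnitalStarSubalgebra ℂ A}

/-- The whole spectrum is the greatest compact subset, and its corner is all of `A`, so the tameness
limit is eventually constant. -/
theorem IsTopography.isTame (hM : IsTopography M) (S : Set (WeakDual ℂ A)) : IsTame L M S := by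
  let T : TopologicalSpace.Compacts (characterSpace ℂ M) := ⟨Set.univ, hM.isCompact_univ⟩
  refine (tendsto_congr' ?_).2 tendsto_const_nhds
  filter_upwards [eventually_ge_atTop T] with K hK
  have e : (K : Set (characterSpace ℂ M)) = Set.univ := Set.univ_subset_iff.1 hK
  simp only [e, hM.corner_univ]
  simp

theorem IsQLCMS.metrizes_states (h : IsQLCMS L M) : Metrizes L (states A) :=
  h.metrizes _ subset_rfl (h.topography.isTame _)

theorem IsTopography.loc_univ (hM : IsTopography M) :
    Loc L M Set.univ = {a | IsSelfAdjoint a ∧ L a < ⊤} := by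
  ext a
  exact ⟨fun h => ⟨h.1, h.2.2⟩, fun h => ⟨h.1, hM.corner_univ a, h.2⟩⟩

end Unital

/-- An approximate unit of `D` converges to `1`, so its image, an approximate unit of `A`, converges
to `π 1`. -/
theorem IsTopographic.map_one {D A : Type*} [CStarAlgebra D] [NonUnitalCStarAlgebra A]
    {N : NonUnitalStarSubalgebra ℂ D} {M : NonUnitalStarSubalgebra ℂ A} {π : D →⋆ₙₐ[ℂ] A}
    (h : IsTopographic N M π) (a : A) : π 1 * a = a ∧ a * π 1 = a := by
  obtain ⟨l, hl, -, hlπ⟩ := h.approxUnit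
  have := hl.neBot
  have h1 : Tendsto π l (𝓝 (π 1)) :=
    (continuous_starAlgHom π).continuousAt.tendsto.comp (tendsto_one_of_isApproximateUnit hl)
  exact ⟨tendsto_nhds_unique (h1.mul_const a) (tendsto_map'_iff.1 (hlπ.tendsto_mul_right a)),
    tendsto_nhds_unique (h1.const_mul a) (tendsto_map'_iff.1 (hlπ.tendsto_mul_left a))⟩

theorem IsTopographic.map_eq_one {D A : Type*} [CStarAlgebra D] [CStarAlgebra A]
    {N : NonUnitalStarSubalgebra ℂ D} {M : NonUnitalStarSubalgebra ℂ A} {π : D →⋆ₙₐ[ℂ] A}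
    (h : IsTopographic N M π) : π 1 = 1 := by
  rw [← (h.map_one 1).1, mul_one]

/-! ### Tunnels out of spaces with a unit -/

namespace Passage

section
variable {A B D : Type*} [CStarAlgebra A] [NonUnitalCStarAlgebra B] [NonUnitalCStarAlgebra D]
  {X : PointedTriple A} {Y : PointedTriple B} {τ : Passage X Y D} {r ε : ℝ}
  {K : Set (characterSpace ℂ τ.M)}

theorem IsLeftAdmissible.exists_lift_one [Nontrivial A] (h : τ.IsLeftAdmissible r ε K)
    (hL : IsLipschitzPair X.L) (hM : IsTopography X.M)
    (hX : specBall X.L X.M X.base r = Set.univ) :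
    ∃ d ∈ Loc τ.L τ.M K, ∃ t : ℝ, t ≠ 0 ∧ ∀ b, d * b = (t : ℂ) • b ∧ b * d = (t : ℂ) • b := by
  -- The lift has Lip-norm at most that of the unit, namely `0`, so it acts as a scalar; it cannot
  -- act as `0`, since it maps to `1`.
  obtain ⟨_, d, ⟨hd, hd1, -, hdL⟩, -⟩ := h.target_nonempty 1 (by
    rw [PointedTriple.locBall, hX, hM.loc_univ, Set.mem_ofPred_eq, hL.apply_one]
    exact ⟨IsSelfAdjoint.one A, ENNReal.zero_lt_top⟩)
  rw [hL.apply_one, le_zero_iff] at hdL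
  obtain ⟨-, t, ht⟩ := (τ.qlcms.lipschitz.eq_zero_iff d).1 hdL
  refine ⟨d, hd, t, ?_, ht⟩
  rintro rfl
  have h1 := congrArg τ.left (ht d).1
  rw [map_mul, hd1, mul_one, Complex.ofReal_zero, zero_smul, map_zero] at h1
  exact one_ne_zero h1

theorem IsLeftAdmissible.hasUnit [Nontrivial A] (h : τ.IsLeftAdmissible r ε K)
    (hL : IsLipschitzPair X.L) (hM : IsTopography X.M)
    (hX : specBall X.L X.M X.base r = Set.univ) : HasUnit D := by
  obtain ⟨d, -, t, ht, hd⟩ := h.exists_lift_one hL hM hX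
  have ht' : (t : ℂ) ≠ 0 := Complex.ofReal_ne_zero.2 ht
  exact ⟨(t : ℂ)⁻¹ • d, fun b => by
    rw [smul_mul_assoc, mul_smul_comm, (hd b).1, (hd b).2, smul_smul, inv_mul_cancel₀ ht',
      one_smul]
    exact ⟨rfl, rfl⟩⟩

end

section
variable {A B D : Type*} [CStarAlgebra A] [NonUnitalCStarAlgebra B] [CStarAlgebra D]
  {X : PointedTriple A} {Y : PointedTriple B} {τ : Passage X Y D} {r ε : ℝ}
  {K : Set (characterSpace ℂ τ.M)}

theorem IsLeftAdmissible.eq_univ [Nontrivial A] (h : τ.IsLeftAdmissible r ε K)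
    (hL : IsLipschitzPair X.L) (hM : IsTopography X.M)
    (hX : specBall X.L X.M X.base r = Set.univ) : K = Set.univ := by
  obtain ⟨d, hdK, t, ht, hd⟩ := h.exists_lift_one hL hM hX
  have ht' : (t : ℂ) ≠ 0 := Complex.ofReal_ne_zero.2 ht
  have e : d = (t : ℂ) • (1 : D) := by rw [← (hd 1).1, mul_one]
  refine τ.qlcms.topography.eq_univ_of_arensMul_indicator h.isCompact ?_
  have h1 := hdK.2.1
  -- As `d` acts as `t`, the support condition `1_K d 1_K = d` becomes `t 1_K 1_K = t 1`, and `t`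
  -- can be cancelled.
  have h2 : ∀ (F : Bidual D) (φ : StrongDual ℂ D), arensMul (toBidual d) F φ = (t : ℂ) * F φ := by
    intro F φ
    rw [arensMul_apply, ← smul_eq_mul, ← map_smul]
    change F _ = F _
    congr 1
    ext b
    change φ (d * b) = (t : ℂ) * φ b
    rw [(hd b).1, map_smul, smul_eq_mul]
  ext φ
  have h3 := congrArg (fun F : Bidual D => F φ) h1
  simp only [corner] at h3
  rw [arensMul_apply] at h3 ⊢
  have h4 : arensMul (toBidual d) (indicator τ.M K) = (t : ℂ) • indicator τ.M K :=
    ContinuousLinearMap.ext fun φ => h2 _ φ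
  rw [h4] at h3
  have h5 : (((t : ℂ) • indicator τ.M K) ∘L (ContinuousLinearMap.compL ℂ D D ℂ φ) ∘L
      ContinuousLinearMap.mul ℂ D) = (t : ℂ) • (indicator τ.M K ∘L
        (ContinuousLinearMap.compL ℂ D D ℂ φ) ∘L ContinuousLinearMap.mul ℂ D) := rfl
  rw [h5, map_smul, smul_eq_mul] at h3
  apply mul_left_cancel₀ ht'
  rw [h3, e]
  change φ ((t : ℂ) • (1 : D)) = t * φ 1
  rw [map_smul, smul_eq_mul]

/-- With `K` the whole spectrum, contractivity of `π_1` is the last left-admissibility condition of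
the inverse passage; the lifting condition gives the reverse inequality. -/
theorem IsAdmissiblePair.isQuotientLip (h : τ.IsAdmissiblePair r ε Set.univ)
    (hM : IsTopography X.M) (hX : specBall X.L X.M X.base r = Set.univ) :
    IsQuotientLip τ.L X.L τ.left := by
  intro a ha
  apply le_antisymm
  · refine le_iInf₂ fun d hd => ?_
    by_cases hdt : τ.L d = ⊤
    · rw [hdt]; exact le_top
    · rw [← hd.2]
      refine h.right.right_le d ?_
      change d ∈ Loc τ.L τ.M Set.univ
      rw [τ.qlcms.topography.loc_univ]
      exact ⟨hd.1, lt_top_iff_ne_top.2 hdt⟩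
  · by_cases hat : X.L a = ⊤
    · rw [hat]; exact le_top
    · obtain ⟨_, d, ⟨hd, hda, -, hdL⟩, -⟩ := h.left.target_nonempty a (by
        rw [PointedTriple.locBall, hX, hM.loc_univ]
        exact ⟨ha, lt_top_iff_ne_top.2 hat⟩)
      exact iInf₂_le_of_le d ⟨hd.1, hda⟩ hdL

theorem IsAdmissiblePair.isLeibnizQCMS (h : τ.IsAdmissiblePair r ε Set.univ) :
    IsLeibnizQCMS τ.L where
  leibniz := ⟨τ.qlcms.lipschitz, LeibnizOn.of_finite τ.qlcms.lipschitz (by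
    have := h.leibniz
    rwa [τ.qlcms.topography.loc_univ] at this)⟩
  hasUnit := hasUnit_of_cstarAlgebra D
  lsc := τ.lsc
  metrizes := τ.qlcms.metrizes_states

end

theorem IsAdmissiblePair.symm {A B D : Type*} [NonUnitalCStarAlgebra A] [NonUnitalCStarAlgebra B]
    [NonUnitalCStarAlgebra D] {X : PointedTriple A} {Y : PointedTriple B} {τ : Passage X Y D}
    {r ε : ℝ} {K : Set (characterSpace ℂ τ.M)} (h : τ.IsAdmissiblePair r ε K) :
    τ.symm.IsAdmissiblePair r ε K where
  left := h.right
  right := h.left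
  base := by
    refine le_trans (le_of_eq ?_) h.base
    exact iSup_congr fun m => iSup_congr fun _ => enorm_sub_rev _ _
  leibniz := h.leibniz

theorem IsTunnel.symm {A B D : Type*} [NonUnitalCStarAlgebra A] [NonUnitalCStarAlgebra B]
    [NonUnitalCStarAlgebra D] {X : PointedTriple A} {Y : PointedTriple B} {τ : Passage X Y D}
    {r : ℝ} (h : τ.IsTunnel r) : τ.symm.IsTunnel r := by
  obtain ⟨hr, ε, hε, K, hK, hadm⟩ := h
  exact ⟨hr, ε, hε, K, hK, fun t ht => (hadm t ht).symm⟩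

end Passage

/-! ### The proposition for the domain of the left morphism's target -/

theorem IsProperQMS.isLeibnizQCMS {A : Type*} [NonUnitalCStarAlgebra A] {L : A → ℝ≥0∞}
    {M : NonUnitalStarSubalgebra ℂ A} (h : IsProperQMS L M) (h1 : HasUnit A) :
    IsLeibnizQCMS L := by
  refine ⟨h.leibniz, h1, h.lsc, ?_⟩
  obtain ⟨_, rfl⟩ := h1.exists_cstarAlgebra
  exact h.qlcms.metrizes_states

theorem nontrivial_of_characterSpace {A : Type*} [NonUnitalCStarAlgebra A]
    {M : NonUnitalStarSubalgebra ℂ A} (χ : characterSpace ℂ M) : Nontrivial A := by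
  by_contra hA
  rw [not_nontrivial_iff_subsingleton] at hA
  exact χ.2.1 (ContinuousLinearMap.ext fun m => by
    have : Subsingleton M := Subtype.val_injective.subsingleton
    exact (congrArg (toStrongDual (χ : WeakDual ℂ M)) (Subsingleton.elim m 0)).trans (map_zero _))

/-- Tunnels out of a pointed proper quantum metric space of small diameter. -/
theorem Passage.compact_of_specDiam_le {A₁ A₂ D : Type*} [NonUnitalCStarAlgebra A₁]
    [NonUnitalCStarAlgebra A₂] [NonUnitalCStarAlgebra D] {X₁ : PointedTriple A₁}
    {X₂ : PointedTriple A₂} {τ : Passage X₁ X₂ D} {r : ℝ} (h₁ : IsProperQMS X₁.L X₁.M)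
    (h₂ : IsProperQMS X₂.L X₂.M) (hτ : τ.IsTunnel r)
    (hr : specDiam X₁.L X₁.M ≤ ENNReal.ofReal r) :
    (IsLeibnizQCMS X₁.L ∧ IsLeibnizQCMS X₂.L ∧ IsLeibnizQCMS τ.L ∧
      ∀ (ε : ℝ) (K : Set (characterSpace ℂ τ.M)), τ.IsAdmissiblePair r ε K → K = Set.univ) ∧
    IsQuotientLip τ.L X₁.L τ.left ∧ Function.Surjective τ.left := by
  have hX := specBall_eq_univ X₁.base hr
  have hA₁ := h₁.qlcms.topography.hasUnit (h₁.isCompact_univ hX)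
  have := nontrivial_of_characterSpace X₁.base
  have hL₁ := h₁.isLeibnizQCMS hA₁
  obtain ⟨_, rfl⟩ := hA₁.exists_cstarAlgebra
  obtain ⟨hr0, ε, hε, K, -, hadm⟩ := hτ
  have hK := hadm r ⟨hr0, le_rfl⟩
  obtain ⟨_, rfl⟩ := (hK.left.hasUnit h₁.leibniz.1 h₁.qlcms.topography hX).exists_cstarAlgebra
  have hU : ∀ (ε : ℝ) (K : Set (characterSpace ℂ τ.M)), τ.IsAdmissiblePair r ε K → K = Set.univ :=
    fun ε K h => h.left.eq_univ h₁.leibniz.1 h₁.qlcms.topography hX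
  rw [hU _ _ hK] at hK
  have hq := hK.isQuotientLip h₁.qlcms.topography hX
  exact ⟨⟨hL₁, h₂.isLeibnizQCMS ⟨_, τ.topographic_right.map_one⟩, hK.isLeibnizQCMS, hU⟩, hq,
    hq.surjective h₁.leibniz.1⟩

/-! ### The Monge-Kantorovich metric -/

section Kantorovich
variable {A : Type*} [NonUnitalCStarAlgebra A] {L : A → ℝ≥0∞}

theorem kantorovich_le_iff {φ ψ : WeakDual ℂ A} {c : ℝ≥0∞} :
    kantorovich L φ ψ ≤ c ↔ ∀ a, IsSelfAdjoint a → L a ≤ 1 → ‖φ a - ψ a‖ₑ ≤ c := by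
  simp only [kantorovich, iSup_le_iff, and_imp]

theorem enorm_sub_le_kantorovich (φ ψ : WeakDual ℂ A) {a : A} (ha : IsSelfAdjoint a)
    (hL : L a ≤ 1) : ‖φ a - ψ a‖ₑ ≤ kantorovich L φ ψ :=
  kantorovich_le_iff.1 le_rfl a ha hL

theorem kantorovich_self (φ : WeakDual ℂ A) : kantorovich L φ φ = 0 :=
  le_zero_iff.1 (kantorovich_le_iff.2 fun a _ _ => by rw [sub_self, enorm_zero])

theorem kantorovich_comm (φ ψ : WeakDual ℂ A) : kantorovich L φ ψ = kantorovich L ψ φ :=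
  iSup_congr fun _ => iSup_congr fun _ => enorm_sub_rev _ _

theorem kantorovich_triangle (φ ψ ω : WeakDual ℂ A) :
    kantorovich L φ ω ≤ kantorovich L φ ψ + kantorovich L ψ ω := by
  refine kantorovich_le_iff.2 fun a ha hL => ?_
  rw [← sub_add_sub_cancel (φ a) (ψ a)]
  exact (enorm_add_le _ _).trans (add_le_add (enorm_sub_le_kantorovich _ _ ha hL)
    (enorm_sub_le_kantorovich _ _ ha hL))

theorem kantorovich_convex {φ φ' ψ ψ' : WeakDual ℂ A} {c : ℝ≥0∞} (h : kantorovich L φ ψ ≤ c)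
    (h' : kantorovich L φ' ψ' ≤ c) {s t : ℝ} (hs : 0 ≤ s) (ht : 0 ≤ t) (hst : s + t = 1) :
    kantorovich L (s • φ + t • φ') (s • ψ + t • ψ') ≤ c := by
  rw [kantorovich_le_iff] at h h' ⊢
  intro a ha hL
  have e : (s • φ + t • φ') a - (s • ψ + t • ψ') a = s • (φ a - ψ a) + t • (φ' a - ψ' a) := by
    change (s • φ a + t • φ' a) - (s • ψ a + t • ψ' a) = _
    rw [smul_sub, smul_sub]
    abel
  rw [e]
  calc _ ≤ ENNReal.ofReal s * ‖φ a - ψ a‖ₑ + ENNReal.ofReal t * ‖φ' a - ψ' a‖ₑ := by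
        refine (enorm_add_le _ _).trans_eq ?_
        rw [enorm_smul, enorm_smul, Real.enorm_of_nonneg hs, Real.enorm_of_nonneg ht]
    _ ≤ ENNReal.ofReal s * c + ENNReal.ofReal t * c := by
        gcongr
        · exact h a ha hL
        · exact h' a ha hL
    _ = c := by rw [← add_mul, ← ENNReal.ofReal_add hs ht, hst, ENNReal.ofReal_one, one_mul]

theorem AlmostSubset.mono_left {X : Type*} {d : X → X → ℝ≥0∞} {ε : ℝ} {S S' T : Set X}
    (h : AlmostSubset d ε S T) (hS : S' ⊆ S) : AlmostSubset d ε S' T :=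
  fun s hs => h s (hS hs)

theorem AlmostSubset.mono_right {X : Type*} {d : X → X → ℝ≥0∞} {ε : ℝ} {S T T' : Set X}
    (h : AlmostSubset d ε S T) (hT : T ⊆ T') : AlmostSubset d ε S T' := fun s hs =>
  let ⟨t, ht, hd⟩ := h s hs
  ⟨t, hT ht, hd⟩

theorem AlmostSubset.mono {X : Type*} {d : X → X → ℝ≥0∞} {ε ε' : ℝ} {S T : Set X}
    (h : AlmostSubset d ε S T) (hε : ε ≤ ε') : AlmostSubset d ε' S T := fun s hs =>
  let ⟨t, ht, hd⟩ := h s hs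
  ⟨t, ht, hd.trans (ENNReal.ofReal_le_ofReal hε)⟩

theorem almostSubset_of_subset {S T : Set (WeakDual ℂ A)} (h : S ⊆ T) (ε : ℝ) :
    AlmostSubset (kantorovich L) ε S T :=
  fun s hs => ⟨s, h hs, by rw [kantorovich_self]; exact zero_le⟩

theorem Metrizes.eventually_lt {S : Set (WeakDual ℂ A)} (h : Metrizes L S) (φ : S) {c : ℝ≥0∞}
    (hc : 0 < c) : ∀ᶠ ψ : S in 𝓝 φ, kantorovich L ψ φ < c := by
  have hopen : IsOpen {ψ : S | kantorovich L ψ φ < c} := by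
    rw [Metrizes] at h
    rw [← h]
    exact TopologicalSpace.isOpen_generateFrom_of_mem ⟨φ, c, rfl⟩
  refine hopen.mem_nhds ?_
  rw [Set.mem_ofPred_eq, kantorovich_self]
  exact hc

/-- Weak* approximation becomes metric approximation inside a set on which the two topologies agree.
-/
theorem Metrizes.exists_of_mem_closure {S T : Set (WeakDual ℂ A)} (h : Metrizes L S) (hT : T ⊆ S)
    {φ : WeakDual ℂ A} (hφS : φ ∈ S) (hφ : φ ∈ closure T) {c : ℝ≥0∞} (hc : 0 < c) :
    ∃ ψ ∈ T, kantorovich L ψ φ < c := by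
  have h1 := h.eventually_lt ⟨φ, hφS⟩ hc
  rw [nhds_subtype_eq_comap, eventually_comap] at h1
  obtain ⟨ψ, hψ, hψT⟩ := mem_closure_iff_nhds.1 hφ _ h1
  exact ⟨ψ, hψT, hψ ⟨ψ, hT hψT⟩ rfl⟩

end Kantorovich

/-! ### Compactness of Lipschitz balls -/

/-- Self-adjoint elements embed isometrically into the continuous functions on the compact state
space. Elements of Lip-norm at most `c` are equicontinuous there because the Monge–Kantorovich
metric induces the weak* topology, so Arzelà–Ascoli gives total boundedness. Lower semicontinuity
makes the ball closed. -/
theorem isCompact_lipschitzBall {D : Type*} [CStarAlgebra D] [Nontrivial D] {L : D → ℝ≥0∞}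
    (hL : IsLipschitzPair L) (hlsc : LowerSemicontinuous L) (hm : Metrizes L (states D))
    {c : ℝ} (hc : 0 < c) (R : ℝ) :
    IsCompact {d : selfAdjoint D | L d ≤ ENNReal.ofReal c ∧ ‖d‖ ≤ R} := by
  have : CompactSpace (states D) := isCompact_iff_compactSpace.1 isCompact_states
  let ι : selfAdjoint D →+ BoundedContinuousFunction (states D) ℂ :=
    { toFun := fun d => BoundedContinuousFunction.mkOfCompact
        ⟨fun φ => (φ : WeakDual ℂ D) d,
          (WeakDual.eval_continuous (d : D)).comp continuous_subtype_val⟩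
      map_zero' := by ext φ; exact map_zero (φ : WeakDual ℂ D)
      map_add' := fun x y => by ext φ; exact map_add (φ : WeakDual ℂ D) (x : D) y }
  have hι : ∀ d φ, ι d φ = (φ : WeakDual ℂ D) d := fun d φ => rfl
  have hiso : Isometry ι := AddMonoidHomClass.isometry_of_norm ι fun d => by
    apply le_antisymm
    · exact (BoundedContinuousFunction.norm_le (norm_nonneg _)).2 fun φ =>
        norm_apply_le_of_mem_states φ.2 d
    · obtain ⟨φ, hφ, hφd⟩ := exists_mem_states_norm_eq d.2
      exact hφd.ge.trans ((ι d).norm_coe_le_norm ⟨φ, hφ⟩)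
  let T : Set (selfAdjoint D) := {d | L d ≤ ENNReal.ofReal c ∧ ‖d‖ ≤ R}
  have hcpt : IsCompact (closure (ι '' T)) := by
    refine BoundedContinuousFunction.arzela_ascoli _ (isCompact_closedBall (0 : ℂ) R) _ ?_ ?_
    · rintro _ φ ⟨d, hd, rfl⟩
      exact mem_closedBall_zero_iff.2 ((norm_apply_le_of_mem_states φ.2 d).trans hd.2)
    · intro φ
      refine Metric.equicontinuousAt_iff_right.2 fun ε hε => ?_
      have hpos : 0 < ε / 2 / c := by positivity
      filter_upwards [hm.eventually_lt φ (ENNReal.ofReal_pos.2 hpos)] with ψ hψ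
      rintro ⟨_, d, hd, rfl⟩
      have h1 := hL.norm_sub_le hc d.2 hd.1 hpos.le hψ.le
      rw [mul_div_cancel₀ _ hc.ne'] at h1
      rw [dist_comm, dist_eq_norm]
      exact h1.trans_lt (half_lt_self hε)
  have : CompleteSpace (selfAdjoint D) :=
    (isClosed_eq continuous_star continuous_id : IsClosed {x : D | star x = x}).completeSpace_coe
  refine TotallyBounded.isCompact_of_isClosed ?_ ?_
  · exact (totallyBounded_image_iff hiso.isUniformInducing).1
      (hcpt.totallyBounded.subset subset_closure)
  · exact ((hlsc.comp continuous_subtype_val).isClosed_preimage (ENNReal.ofReal c)).inter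
      (isClosed_le continuous_norm continuous_const)

/-! ### Pullbacks of states -/

section Pullback
variable {D A : Type*} [CStarAlgebra D] [CStarAlgebra A] {π : D →⋆ₙₐ[ℂ] A}

theorem pullback_states_subset (h1 : π 1 = 1) : pullback π (states A) ⊆ states D := by
  rintro φ ⟨ψ, hψ, h⟩
  refine mem_states_iff.2 ⟨(toStrongDual φ).opNorm_le_bound zero_le_one fun d => ?_, ?_⟩
  · rw [one_mul]
    change ‖φ d‖ ≤ ‖d‖
    rw [h]
    exact (norm_apply_le_of_mem_states hψ _).trans (NonUnitalStarAlgHom.norm_apply_le π d)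
  · rw [h, h1, apply_one_of_mem_states hψ]

theorem exists_pullback (π : D →⋆ₙₐ[ℂ] A) {S : Set (WeakDual ℂ A)} {ψ : WeakDual ℂ A}
    (hψ : ψ ∈ S) : ∃ φ ∈ pullback π S, ∀ d, φ d = ψ (π d) :=
  ⟨StrongDual.toWeakDual ((toStrongDual ψ).comp
    (⟨(π : D →ₗ[ℂ] A), continuous_starAlgHom π⟩ : D →L[ℂ] A)), ⟨ψ, hψ, fun _ => rfl⟩, fun _ => rfl⟩

theorem convex_pullback_states : Convex ℝ (pullback π (states A)) := by
  rintro φ ⟨ψ, hψ, h⟩ φ' ⟨ψ', hψ', h'⟩ s t hs ht hst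
  refine ⟨s • ψ + t • ψ', convex_states hψ hψ' hs ht hst, fun d => ?_⟩
  change s • φ d + t • φ' d = s • ψ (π d) + t • ψ' (π d)
  rw [h, h']

/-- A state attaining `‖d‖` can be moved by at most `ε` to one factoring through `π`. This confines
Lipschitz lifts of a fixed element to a bounded set. -/
theorem norm_le_of_almostSubset [Nontrivial D] {L : D → ℝ≥0∞} (hL : IsLipschitzPair L) {ε : ℝ}
    (hε : 0 ≤ ε) (h : AlmostSubset (kantorovich L) ε (states D) (pullback π (states A)))
    {d : D} (hd : IsSelfAdjoint d) {c : ℝ} (hc : 0 < c) (hdL : L d ≤ ENNReal.ofReal c) :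
    ‖d‖ ≤ ‖π d‖ + c * ε := by
  obtain ⟨φ, hφ, hφd⟩ := exists_mem_states_norm_eq hd
  obtain ⟨ψ, ⟨ω, hω, hψ⟩, hk⟩ := h φ hφ
  have h1 := hL.norm_sub_le hc hd hdL hε hk
  have h2 := norm_apply_le_of_mem_states hω (π d)
  rw [← hψ] at h2
  have h3 := norm_le_norm_add_norm_sub' (φ d) (ψ d)
  rw [← hφd]
  linarith

/-- Quotient seminorms are attained. -/
theorem IsQuotientLip.exists_lift_le [Nontrivial D] {LD : D → ℝ≥0∞} {LA : A → ℝ≥0∞}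
    (h : IsQuotientLip LD LA π) (hL : IsLipschitzPair LD) (hlsc : LowerSemicontinuous LD)
    (hm : Metrizes LD (states D)) {ε : ℝ} (hε : 0 ≤ ε)
    (hs : AlmostSubset (kantorovich LD) ε (states D) (pullback π (states A))) {a : A}
    (ha : IsSelfAdjoint a) (hLA : LA a < ⊤) :
    ∃ d, IsSelfAdjoint d ∧ π d = a ∧ LD d ≤ LA a := by
  -- The added `1` makes `c` positive and leaves room for a lift of Lip-norm strictly below `c`; all
  -- such lifts lie in one compact set.
  let c : ℝ := (LA a).toReal + 1
  have hc : 0 < c := by positivity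
  have hlt : LA a < ENNReal.ofReal c :=
    (ENNReal.lt_ofReal_iff_toReal_lt hLA.ne).2 (lt_add_one _)
  have hcpt := (isCompact_lipschitzBall hL hlsc hm hc (‖a‖ + c * ε)).inter_right
    (isClosed_eq ((continuous_starAlgHom π).comp continuous_subtype_val)
      (continuous_const (y := a)))
  have hmem : ∀ d, IsSelfAdjoint d → π d = a → LD d < ENNReal.ofReal c →
      ∃ d' ∈ {d : selfAdjoint D | LD d ≤ ENNReal.ofReal c ∧ ‖d‖ ≤ ‖a‖ + c * ε} ∩
        {d | (π ∘ Subtype.val) d = a}, (d' : D) = d := by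
    intro d hd hda hdc
    have := norm_le_of_almostSubset hL hε hs hd hc hdc.le
    rw [hda] at this
    exact ⟨⟨d, hd⟩, ⟨⟨hdc.le, this⟩, hda⟩, rfl⟩
  obtain ⟨d₀, hd₀, hda₀, hdc₀⟩ := h.exists_lift ha hlt
  obtain ⟨d₀', hd₀', -⟩ := hmem d₀ hd₀ hda₀ hdc₀
  obtain ⟨d, ⟨-, hda⟩, hmin⟩ := (hlsc.comp continuous_subtype_val).lowerSemicontinuousOn _
    |>.exists_isMinOn ⟨_, hd₀'⟩ hcpt
  refine ⟨d, d.2, hda, le_of_forall_gt fun b hb => ?_⟩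
  -- Taking the minimum with `c` keeps the competing lift in the compact set, where the minimiser
  -- can be compared with it.
  obtain ⟨x, hx, hxa, hxb⟩ := h.exists_lift ha (lt_min hb hlt)
  obtain ⟨x', hx', rfl⟩ := hmem x hx hxa (hxb.trans_le (min_le_right _ _))
  exact (hmin hx').trans_lt (hxb.trans_le (min_le_left _ _))

end Pullback

/-! ### The canonical pointed space of a quantum compact metric space -/

section Canonical
variable (A : Type*) [CStarAlgebra A] [Nontrivial A]

theorem isTopography_scalars : IsTopography (scalars A) where
  isClosed := (algebraMap_isometry ℂ A).isClosedEmbedding.isClosed_range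
  comm := by
    rintro _ ⟨z, rfl⟩ y -
    exact Algebra.commutes z y
  approxUnit := ⟨pure 1, IsApproximateUnit.pure_one A, mem_pure.2 ⟨1, map_one _⟩⟩

variable {A}

/-- The spectrum of `ℂ1` is a single point, so balls, and everything localised to them, are global
whatever the radius. -/
theorem character_scalars (χ : characterSpace ℂ (scalars A)) (m : scalars A) :
    χ m = scalarsBase A m := by
  have h1 : (1 : A) ∈ scalars A := (isTopography_scalars A).one_mem
  have e : m = scalarsBase A m • (⟨1, h1⟩ : scalars A) := Subtype.ext (by
    rw [← algebraMap_scalarsBase m]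
    exact Algebra.algebraMap_eq_smul_one _)
  conv_lhs => rw [e]
  rw [map_smul, character_one, smul_eq_mul, mul_one]

theorem specBall_canonicalTriple (L : A → ℝ≥0∞) (r : ℝ) :
    specBall (canonicalTriple L).L (canonicalTriple L).M (canonicalTriple L).base r =
      Set.univ := by
  refine Set.eq_univ_of_forall fun χ => ?_
  change specKantorovich L (scalars A) χ (scalarsBase A) ≤ ENNReal.ofReal r
  refine iSup₂_le fun m _ => ?_
  rw [character_scalars χ m, sub_self, enorm_zero]
  exact zero_le

theorem statesBall_canonicalTriple (L : A → ℝ≥0∞) (r : ℝ) :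
    (canonicalTriple L).statesBall r = states A := by
  rw [PointedTriple.statesBall, specBall_canonicalTriple]
  exact (isTopography_scalars A).statesOn_univ

theorem locBall_canonicalTriple (L : A → ℝ≥0∞) (r : ℝ) :
    (canonicalTriple L).locBall r = {a | IsSelfAdjoint a ∧ L a < ⊤} := by
  rw [PointedTriple.locBall, specBall_canonicalTriple]
  exact (isTopography_scalars A).loc_univ

theorem state_apply_scalars {φ : WeakDual ℂ A} (hφ : φ ∈ states A) (m : scalars A) :
    φ m = scalarsBase A m := by
  rw [← algebraMap_scalarsBase m, Algebra.algebraMap_eq_smul_one, map_smul,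
    apply_one_of_mem_states hφ, smul_eq_mul, mul_one]

theorem states_nonempty : (states A).Nonempty := by
  obtain ⟨φ, hφ, -⟩ := exists_mem_states_norm_eq (IsSelfAdjoint.one A)
  exact ⟨φ, hφ⟩

end Canonical

/-! ### Admissibility for compact tunnels as closeness of states -/

section Tunnel
variable {A B D : Type*} [CStarAlgebra A] [Nontrivial A] [CStarAlgebra B] [Nontrivial B]
  [CStarAlgebra D] {LA : A → ℝ≥0∞} {LB : B → ℝ≥0∞}
  {τ : Passage (canonicalTriple LA) (canonicalTriple LB) D}

/-- All states of `D` are `ε`-close to states factoring through either of the two morphisms. -/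
def Passage.StatesClose {A B D : Type*} [NonUnitalCStarAlgebra A] [NonUnitalCStarAlgebra B]
    [NonUnitalCStarAlgebra D] {X : PointedTriple A} {Y : PointedTriple B} (τ : Passage X Y D)
    (ε : ℝ) : Prop :=
  AlmostSubset (kantorovich τ.L) ε (states D) (pullback τ.left (states A)) ∧
    AlmostSubset (kantorovich τ.L) ε (states D) (pullback τ.right (states B))

theorem isLeftAdmissible_univ [Nontrivial D] (hD : IsLeibnizQCMS τ.L)
    (hqA : IsQuotientLip τ.L LA τ.left)
    (hqB : IsQuotientLip τ.L LB τ.right) {ε : ℝ} (hε : 0 < ε) (hs : τ.StatesClose ε) (r : ℝ) :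
    τ.IsLeftAdmissible r ε Set.univ where
  pos := hε
  isCompact := τ.qlcms.topography.isCompact_univ
  pullback_subset := by
    rw [statesBall_canonicalTriple, τ.qlcms.topography.statesOn_univ]
    exact pullback_states_subset τ.topographic_left.map_eq_one
  almostSubset := by
    rw [statesBall_canonicalTriple, τ.qlcms.topography.statesOn_univ]
    exact hs.1
  target_nonempty := by
    intro a ha
    rw [locBall_canonicalTriple] at ha
    -- Admissibility asks for a lift with no loss in the Lip-norm, so the infimum defining the
    -- quotient has to be attained.
    obtain ⟨d, hd, hda, hdL⟩ := hqA.exists_lift_le τ.qlcms.lipschitz τ.lsc hD.metrizes hε.le hs.1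
      ha.1 ha.2
    have hdt := hdL.trans_lt ha.2
    refine ⟨τ.right d, d, ⟨?_, hda, ?_, hdL⟩, rfl⟩
    · rw [τ.qlcms.topography.loc_univ]
      exact ⟨hd, hdt⟩
    · rw [locBall_canonicalTriple]
      exact ⟨hd.map τ.right, (hqB.apply_le hd).trans_lt hdt⟩
  target_topography := by
    rintro a ⟨ha, ⟨z, rfl⟩⟩
    -- Local elements are self-adjoint, so `a` is a real scalar. The same scalar in `D` is a lift of
    -- Lip-norm `0` with scalar image in `B`.
    have hz : star z = z := by
      apply FaithfulSMul.algebraMap_injective ℂ A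
      rw [algebraMap_star_comm]
      exact ha.1
    obtain ⟨t, rfl⟩ : ∃ t : ℝ, (t : ℂ) = z := Complex.conj_eq_iff_real.1 hz |>.imp fun _ h => h.symm
    have hd : IsSelfAdjoint ((t : ℂ) • (1 : D)) :=
      isSelfAdjoint_ofReal_smul (IsSelfAdjoint.one D) t
    have hdL : τ.L ((t : ℂ) • (1 : D)) = 0 := τ.qlcms.lipschitz.apply_real_smul_one t
    have hB : τ.right ((t : ℂ) • (1 : D)) = algebraMap ℂ B t := by
      rw [map_smul, τ.topographic_right.map_eq_one, Algebra.algebraMap_eq_smul_one]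
    refine ⟨_, ⟨(t : ℂ) • (1 : D), ⟨?_, ?_, ?_, ?_⟩, rfl⟩, ?_⟩
    · rw [τ.qlcms.topography.loc_univ, Set.mem_ofPred_eq, hdL]
      exact ⟨hd, ENNReal.zero_lt_top⟩
    · rw [map_smul, τ.topographic_left.map_eq_one, Algebra.algebraMap_eq_smul_one]
    · rw [locBall_canonicalTriple]
      exact ⟨hd.map τ.right, (hqB.apply_le hd).trans_lt (by rw [hdL]; exact ENNReal.zero_lt_top)⟩
    · rw [hdL]; exact zero_le
    · rw [hB]; exact ⟨_, rfl⟩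
  right_le := fun d hd => hqB.apply_le hd.1

theorem Passage.StatesClose.symm {ε : ℝ} (hs : τ.StatesClose ε) : τ.symm.StatesClose ε :=
  ⟨hs.2, hs.1⟩

theorem isAdmissiblePair_univ [Nontrivial D] (h : IsCompactTunnel τ.L LA LB τ.left τ.right)
    {ε : ℝ} (hε : 0 < ε) (hs : τ.StatesClose ε) (r : ℝ) : τ.IsAdmissiblePair r ε Set.univ where
  left := isLeftAdmissible_univ h.isLeibnizQCMS h.quotient_left h.quotient_right hε hs r
  right := isLeftAdmissible_univ (τ := τ.symm) h.isLeibnizQCMS h.quotient_right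
    h.quotient_left hε hs.symm r
  base := by
    refine iSup₂_le fun m hm => ?_
    -- Any pulled back state agrees on `M_D` with the pulled back base point, since its values there
    -- are taken on scalars. Closeness of states therefore bounds the distance of the base points.
    obtain ⟨ψ, hψ⟩ := states_nonempty (A := A)
    obtain ⟨φ, hφ, hφψ⟩ := exists_pullback τ.left hψ
    obtain ⟨φ', ⟨ω, hω, hφ'⟩, hk⟩ :=
      hs.2 φ (pullback_states_subset τ.topographic_left.map_eq_one hφ)
    have h1 := (enorm_sub_le_kantorovich φ φ' (congrArg Subtype.val hm.1) hm.2).trans hk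
    have e1 : φ m = Passage.baseComp τ.topographic_left (canonicalTriple LA).base m := by
      rw [hφψ]
      exact state_apply_scalars hψ ⟨τ.left m, τ.topographic_left.maps m m.2⟩
    have e2 : φ' m = Passage.baseComp τ.topographic_right (canonicalTriple LB).base m := by
      rw [hφ']
      exact state_apply_scalars hω ⟨τ.right m, τ.topographic_right.maps m m.2⟩
    rwa [e1, e2] at h1
  leibniz := fun a ha b hb => h.isLeibnizQCMS.leibniz.2 a ha.1 b hb.1

theorem Passage.IsAdmissiblePair.isCompactTunnel (hLA : IsLipschitzPair LA)
    (hLB : IsLipschitzPair LB) {r ε : ℝ} (h : τ.IsAdmissiblePair r ε Set.univ) :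
    IsCompactTunnel τ.L LA LB τ.left τ.right := by
  have hA := h.isQuotientLip (isTopography_scalars A) (specBall_canonicalTriple LA r)
  have hB := h.symm.isQuotientLip (isTopography_scalars B) (specBall_canonicalTriple LB r)
  exact ⟨h.isLeibnizQCMS, hA.surjective hLA, hB.surjective hLB, hA, hB⟩

theorem Passage.IsAdmissiblePair.statesClose {r ε : ℝ} (h : τ.IsAdmissiblePair r ε Set.univ) :
    τ.StatesClose ε := by
  have h1 := h.left.almostSubset
  have h2 : AlmostSubset (kantorovich τ.L) ε (statesOn τ.M Set.univ)
    (pullback τ.right ((canonicalTriple LB).statesBall (r + 4 * ε))) := h.right.almostSubset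
  rw [statesBall_canonicalTriple, τ.qlcms.topography.statesOn_univ] at h1 h2
  exact ⟨h1, h2⟩

theorem isAdmissiblePair_eq_univ (hLA : IsLipschitzPair LA) {r ε : ℝ}
    {K : Set (characterSpace ℂ τ.M)} (h : τ.IsAdmissiblePair r ε K) : K = Set.univ :=
  h.left.eq_univ hLA (isTopography_scalars A) (specBall_canonicalTriple LA r)

theorem isCompactTunnel_of_mem_adm (hLA : IsLipschitzPair LA) (hLB : IsLipschitzPair LB)
    {r ε : ℝ} (hr : 0 < r) (h : ε ∈ τ.Adm r) :
    IsCompactTunnel τ.L LA LB τ.left τ.right ∧ 0 < ε ∧ τ.StatesClose ε := by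
  obtain ⟨hε, K, -, hK⟩ := h
  have h1 := hK r ⟨hr, le_rfl⟩
  rw [isAdmissiblePair_eq_univ hLA h1] at h1
  exact ⟨h1.isCompactTunnel hLA hLB, hε, h1.statesClose⟩

/-- The right side does not involve `r`, whence the independence of the extent from `r`. The
constant family `K_t` equal to the whole spectrum serves every radius. -/
theorem mem_adm_iff [Nontrivial D] (hLA : IsLipschitzPair LA) (hLB : IsLipschitzPair LB)
    (h : IsCompactTunnel τ.L LA LB τ.left τ.right) {r ε : ℝ} (hr : 0 < r) :
    ε ∈ τ.Adm r ↔ 0 < ε ∧ τ.StatesClose ε :=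
  ⟨fun hε => (isCompactTunnel_of_mem_adm hLA hLB hr hε).2, fun hε => ⟨hε.1, fun _ => Set.univ,
    fun _ _ _ _ _ => subset_rfl, fun t _ => isAdmissiblePair_univ h hε.1 hε.2 t⟩⟩

/-! ### Extent and length -/

theorem hausdorff_le {X : Type*} {d : X → X → ℝ≥0∞} {S T : Set X} {ε : ℝ} (hε : 0 < ε)
    (h₁ : AlmostSubset d ε S T) (h₂ : AlmostSubset d ε T S) :
    hausdorff d S T ≤ ENNReal.ofReal ε :=
  iInf₂_le ε ⟨hε, h₁, h₂⟩

theorem exists_of_hausdorff_lt {X : Type*} {d : X → X → ℝ≥0∞} {S T : Set X} {c : ℝ≥0∞}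
    (h : hausdorff d S T < c) : ∃ ε : ℝ, 0 < ε ∧ ENNReal.ofReal ε < c ∧ AlmostSubset d ε S T ∧
      AlmostSubset d ε T S := by
  simp only [hausdorff, iInf_lt_iff] at h
  obtain ⟨ε, ⟨hε, h₁, h₂⟩, hc⟩ := h
  exact ⟨ε, hε, hc, h₁, h₂⟩

theorem pullback_left_subset : pullback τ.left (states A) ⊆ states D :=
  pullback_states_subset τ.topographic_left.map_eq_one

theorem pullback_right_subset : pullback τ.right (states B) ⊆ states D :=
  pullback_states_subset τ.topographic_right.map_eq_one

theorem Passage.StatesClose.compactExtent_le {ε : ℝ} (hε : 0 < ε) (hs : τ.StatesClose ε) :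
    compactExtent τ.L τ.left τ.right ≤ ENNReal.ofReal ε :=
  max_le (hausdorff_le hε hs.1 (almostSubset_of_subset pullback_left_subset ε))
    (hausdorff_le hε hs.2 (almostSubset_of_subset pullback_right_subset ε))

theorem statesClose_of_compactExtent_lt {ε : ℝ}
    (h : compactExtent τ.L τ.left τ.right < ENNReal.ofReal ε) : 0 < ε ∧ τ.StatesClose ε := by
  obtain ⟨ε₁, hε₁, hlt₁, h₁, -⟩ := exists_of_hausdorff_lt ((le_max_left _ _).trans_lt h)
  obtain ⟨ε₂, hε₂, hlt₂, h₂, -⟩ := exists_of_hausdorff_lt ((le_max_right _ _).trans_lt h)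
  have b₁ := (ENNReal.ofReal_lt_ofReal_iff_of_nonneg hε₁.le).1 hlt₁
  have b₂ := (ENNReal.ofReal_lt_ofReal_iff_of_nonneg hε₂.le).1 hlt₂
  exact ⟨hε₁.trans b₁, h₁.mono b₁.le, h₂.mono b₂.le⟩

theorem exists_statesClose_of_compactExtent_lt_top
    (h : compactExtent τ.L τ.left τ.right < ⊤) : ∃ ε : ℝ, 0 < ε ∧ τ.StatesClose ε :=
  ⟨(compactExtent τ.L τ.left τ.right).toReal + 1, statesClose_of_compactExtent_lt
    ((ENNReal.lt_ofReal_iff_toReal_lt h.ne).2 (lt_add_one _))⟩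

/-- Finiteness of the extent keeps the set nonempty, so that the real `sInf` is a genuine infimum
and not its default value `0`. -/
theorem ofReal_sInf_statesClose (h : compactExtent τ.L τ.left τ.right < ⊤) :
    ENNReal.ofReal (sInf {ε | 0 < ε ∧ τ.StatesClose ε}) =
      compactExtent τ.L τ.left τ.right := by
  have hbdd : BddBelow {ε | 0 < ε ∧ τ.StatesClose ε} := ⟨0, fun ε hε => hε.1.le⟩
  apply le_antisymm
  · refine ENNReal.le_of_forall_pos_le_add fun δ hδ _ => ?_
    have h1 : (compactExtent τ.L τ.left τ.right).toReal + δ ∈ {ε | 0 < ε ∧ τ.StatesClose ε} :=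
      statesClose_of_compactExtent_lt ((ENNReal.lt_ofReal_iff_toReal_lt h.ne).2
        (lt_add_of_pos_right _ hδ))
    refine (ENNReal.ofReal_le_ofReal (csInf_le hbdd h1)).trans ?_
    rw [ENNReal.ofReal_add ENNReal.toReal_nonneg δ.coe_nonneg, ENNReal.ofReal_toReal h.ne,
      ENNReal.ofReal_coe_nnreal]
  · refine ENNReal.le_of_forall_pos_le_add fun δ hδ _ => ?_
    obtain ⟨ε, hε, hlt⟩ := Real.lt_sInf_add_pos
      (exists_statesClose_of_compactExtent_lt_top h) (NNReal.coe_pos.2 hδ)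
    refine (hε.2.compactExtent_le hε.1).trans ((ENNReal.ofReal_le_ofReal hlt.le).trans ?_)
    refine ENNReal.ofReal_add_le.trans_eq ?_
    rw [ENNReal.ofReal_coe_nnreal]
    rfl

theorem compactLength_lt_top (h : compactExtent τ.L τ.left τ.right < ⊤) :
    compactLength τ.L τ.left τ.right < ⊤ := by
  obtain ⟨ε, hε, hs⟩ := exists_statesClose_of_compactExtent_lt_top h
  refine max_lt ?_ ?_
  · exact (hausdorff_le hε (hs.2.mono_left pullback_left_subset)
      (hs.1.mono_left pullback_right_subset)).trans_lt ENNReal.ofReal_lt_top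
  · refine (hausdorff_le hε (hs.1.mono_right ?_) (almostSubset_of_subset ?_ ε)).trans_lt
      ENNReal.ofReal_lt_top
    · exact Set.subset_union_left.trans ((subset_convexHull ℝ _).trans subset_closure)
    · exact closure_minimal (convexHull_min
        (Set.union_subset pullback_left_subset pullback_right_subset) convex_states)
        isCompact_states.isClosed

/-- By joint convexity of the metric, the `ε`-neighbourhood of a convex set is convex. -/
theorem AlmostSubset.convexHull_union {A : Type*} [NonUnitalCStarAlgebra A] {L : A → ℝ≥0∞}
    {ε : ℝ} {S T : Set (WeakDual ℂ A)} (hT : Convex ℝ T)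
    (h : AlmostSubset (kantorovich L) ε S T) :
    AlmostSubset (kantorovich L) ε (convexHull ℝ (S ∪ T)) T := by
  have hc : Convex ℝ {φ : WeakDual ℂ A | ∃ ψ ∈ T, kantorovich L φ ψ ≤ ENNReal.ofReal ε} := by
    rintro φ ⟨ψ, hψ, hk⟩ φ' ⟨ψ', hψ', hk'⟩ s t hs ht hst
    exact ⟨_, hT hψ hψ' hs ht hst, kantorovich_convex hk hk' hs ht hst⟩
  exact convexHull_min (Set.union_subset h (almostSubset_of_subset subset_rfl ε)) hc

theorem AlmostSubset.of_closure_convexHull {L : D → ℝ≥0∞} (hm : Metrizes L (states D)) {ε δ : ℝ}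
    (hε : 0 ≤ ε) (hδ : 0 ≤ δ) {S T : Set (WeakDual ℂ D)} (hS : S ⊆ states D) (hT : T ⊆ states D)
    (hTc : Convex ℝ T) (h : AlmostSubset (kantorovich L) ε S T)
    (h' : AlmostSubset (kantorovich L) δ (states D) (closure (convexHull ℝ (S ∪ T)))) :
    -- Three moves: `δ` into the closed hull, `1` from the closure into the hull, `ε` into `T`. The
    -- `1` is an arbitrary positive number, only finiteness of the total being needed.
    AlmostSubset (kantorovich L) (δ + (1 + ε)) (states D) T := by
  have hsub : convexHull ℝ (S ∪ T) ⊆ states D :=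
    convexHull_min (Set.union_subset hS hT) convex_states
  intro φ hφ
  obtain ⟨ψ, hψ, hk⟩ := h' φ hφ
  obtain ⟨ω, hω, hk'⟩ := hm.exists_of_mem_closure hsub
    (closure_minimal hsub isCompact_states.isClosed hψ) hψ one_pos
  obtain ⟨χ, hχ, hk''⟩ := h.convexHull_union hTc ω hω
  refine ⟨χ, hχ, (kantorovich_triangle φ ψ χ).trans ?_⟩
  rw [ENNReal.ofReal_add hδ (by positivity), ENNReal.ofReal_add zero_le_one hε,
    ENNReal.ofReal_one]
  refine add_le_add hk ((kantorovich_triangle ψ ω χ).trans (add_le_add ?_ hk''))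
  rw [kantorovich_comm]
  exact hk'.le

theorem compactExtent_lt_top (hm : Metrizes τ.L (states D))
    (h : compactLength τ.L τ.left τ.right < ⊤) : compactExtent τ.L τ.left τ.right < ⊤ := by
  obtain ⟨ε, hε, -, h₁, h₂⟩ := exists_of_hausdorff_lt ((le_max_left _ _).trans_lt h)
  obtain ⟨δ, hδ, -, h₃, -⟩ := exists_of_hausdorff_lt ((le_max_right _ _).trans_lt h)
  have hs : τ.StatesClose (δ + (1 + ε)) := by
    refine ⟨?_, ?_⟩
    · rw [Set.union_comm] at h₃
      exact AlmostSubset.of_closure_convexHull hm hε.le hδ.le pullback_right_subset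
        pullback_left_subset convex_pullback_states h₂ h₃
    · exact AlmostSubset.of_closure_convexHull hm hε.le hδ.le pullback_left_subset
        pullback_right_subset convex_pullback_states h₁ h₃
  exact (hs.compactExtent_le (by positivity)).trans_lt ENNReal.ofReal_lt_top

end Tunnel

/-! ### The corollary -/

theorem tfae_isTunnel {A B D : Type*} [CStarAlgebra A] [Nontrivial A] [CStarAlgebra B]
    [Nontrivial B] [NonUnitalCStarAlgebra D] {LA : A → ℝ≥0∞} {LB : B → ℝ≥0∞}
    (hLA : IsLipschitzPair LA) (hLB : IsLipschitzPair LB)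
    (τ : Passage (canonicalTriple LA) (canonicalTriple LB) D) :
    List.TFAE [
      ∃ r : ℝ, 0 < r ∧ τ.IsTunnel r,
      IsCompactTunnel τ.L LA LB τ.left τ.right ∧ compactLength τ.L τ.left τ.right < ⊤,
      IsCompactTunnel τ.L LA LB τ.left τ.right ∧ compactExtent τ.L τ.left τ.right < ⊤,
      ∀ r : ℝ, 0 < r → τ.IsTunnel r] ∧
    ((∃ r : ℝ, 0 < r ∧ τ.IsTunnel r) → ∀ r : ℝ, 0 < r →
      ENNReal.ofReal (τ.extent r) = compactExtent τ.L τ.left τ.right) := by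
  -- No unit is assumed in `D`: it comes from lifting the unit of `A` in one direction, and from the
  -- compact tunnel structure in the other.
  have hunit : ∀ r : ℝ, τ.IsTunnel r → HasUnit D := by
    rintro r ⟨hr, ε, hε, K, -, hK⟩
    exact (hK r ⟨hr, le_rfl⟩).left.hasUnit hLA (isTopography_scalars A)
      (specBall_canonicalTriple LA r)
  have h13 : (∃ r : ℝ, 0 < r ∧ τ.IsTunnel r) → IsCompactTunnel τ.L LA LB τ.left τ.right ∧
      compactExtent τ.L τ.left τ.right < ⊤ := by
    rintro ⟨r, hr, hτ⟩
    obtain ⟨_, rfl⟩ := (hunit r hτ).exists_cstarAlgebra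
    obtain ⟨-, ε, hε⟩ := hτ
    obtain ⟨hc, hε0, hs⟩ := isCompactTunnel_of_mem_adm hLA hLB hr hε
    exact ⟨hc, (hs.compactExtent_le hε0).trans_lt ENNReal.ofReal_lt_top⟩
  have h3 : IsCompactTunnel τ.L LA LB τ.left τ.right ∧ compactExtent τ.L τ.left τ.right < ⊤ →
      ∀ r : ℝ, 0 < r → τ.IsTunnel r ∧
        ENNReal.ofReal (τ.extent r) = compactExtent τ.L τ.left τ.right := by
    rintro ⟨hc, hlt⟩ r hr
    have : Nontrivial D := hc.surjective_left.nontrivial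
    obtain ⟨_, rfl⟩ := hc.isLeibnizQCMS.hasUnit.exists_cstarAlgebra
    have hAdm : τ.Adm r = {ε | 0 < ε ∧ τ.StatesClose ε} :=
      Set.ext fun ε => mem_adm_iff hLA hLB hc hr
    refine ⟨⟨hr, ?_⟩, ?_⟩
    · rw [hAdm]
      exact exists_statesClose_of_compactExtent_lt_top hlt
    · rw [Passage.extent, hAdm]
      exact ofReal_sInf_statesClose hlt
  refine ⟨?_, fun h => fun r hr => (h3 (h13 h) r hr).2⟩
  tfae_have 1 → 3 := h13
  tfae_have 3 → 4 := fun h r hr => (h3 h r hr).1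
  tfae_have 4 → 1 := fun h => ⟨1, one_pos, h 1 one_pos⟩
  tfae_have 2 → 3 := by
    rintro ⟨hc, hlt⟩
    refine ⟨hc, ?_⟩
    obtain ⟨_, rfl⟩ := hc.isLeibnizQCMS.hasUnit.exists_cstarAlgebra
    exact compactExtent_lt_top hc.isLeibnizQCMS.metrizes hlt
  tfae_have 3 → 2 := by
    rintro ⟨hc, hlt⟩
    refine ⟨hc, ?_⟩
    obtain ⟨_, rfl⟩ := hc.isLeibnizQCMS.hasUnit.exists_cstarAlgebra
    exact compactLength_lt_top hlt
  tfae_finish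

end QuantumMetric

theorem mainTheorem7 :
    (∀ {A₁ A₂ D : Type*} [NonUnitalCStarAlgebra A₁] [NonUnitalCStarAlgebra A₂]
      [NonUnitalCStarAlgebra D] (X₁ : QuantumMetric.PointedTriple A₁)
      (X₂ : QuantumMetric.PointedTriple A₂) (τ : QuantumMetric.Passage X₁ X₂ D) (r : ℝ),
      QuantumMetric.IsProperQMS X₁.L X₁.M → QuantumMetric.IsProperQMS X₂.L X₂.M →
      0 < r → τ.IsTunnel r →
      (QuantumMetric.specDiam X₁.L X₁.M ≤ ENNReal.ofReal r ∨
          QuantumMetric.specDiam X₂.L X₂.M ≤ ENNReal.ofReal r →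
        QuantumMetric.IsLeibnizQCMS X₁.L ∧ QuantumMetric.IsLeibnizQCMS X₂.L ∧
        QuantumMetric.IsLeibnizQCMS τ.L ∧
        ∀ (ε : ℝ) (K : Set (WeakDual.characterSpace ℂ τ.M)),
          τ.IsAdmissiblePair r ε K → K = Set.univ) ∧
      (QuantumMetric.specDiam X₁.L X₁.M ≤ ENNReal.ofReal r →
        QuantumMetric.IsQuotientLip τ.L X₁.L τ.left ∧ Function.Surjective τ.left) ∧
      (QuantumMetric.specDiam X₂.L X₂.M ≤ ENNReal.ofReal r →
        QuantumMetric.IsQuotientLip τ.L X₂.L τ.right ∧ Function.Surjective τ.right)) ∧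
    (∀ {A B D : Type*} [CStarAlgebra A] [Nontrivial A] [CStarAlgebra B] [Nontrivial B]
      [NonUnitalCStarAlgebra D] (LA : A → ENNReal) (LB : B → ENNReal),
      QuantumMetric.IsLeibnizQCMS LA → QuantumMetric.IsLeibnizQCMS LB →
      ∀ τ : QuantumMetric.Passage (QuantumMetric.canonicalTriple LA)
          (QuantumMetric.canonicalTriple LB) D,
        List.TFAE [
          ∃ r : ℝ, 0 < r ∧ τ.IsTunnel r,
          QuantumMetric.IsCompactTunnel τ.L LA LB τ.left τ.right ∧
            QuantumMetric.compactLength τ.L τ.left τ.right < ⊤,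
          QuantumMetric.IsCompactTunnel τ.L LA LB τ.left τ.right ∧
            QuantumMetric.compactExtent τ.L τ.left τ.right < ⊤,
          ∀ r : ℝ, 0 < r → τ.IsTunnel r] ∧
        ((∃ r : ℝ, 0 < r ∧ τ.IsTunnel r) → ∀ r : ℝ, 0 < r →
          ENNReal.ofReal (τ.extent r) = QuantumMetric.compactExtent τ.L τ.left τ.right)) := by
  refine ⟨fun X₁ X₂ τ r h₁ h₂ _ hτ => ⟨?_, fun hd => ?_, fun hd => ?_⟩, fun LA LB hA hB τ => ?_⟩
  · rintro (hd | hd)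
    · exact (QuantumMetric.Passage.compact_of_specDiam_le h₁ h₂ hτ hd).1
    · obtain ⟨c₂, c₁, cD, hU⟩ :=
        (QuantumMetric.Passage.compact_of_specDiam_le h₂ h₁ hτ.symm hd).1
      exact ⟨c₁, c₂, cD, fun ε K h => hU ε K h.symm⟩
  · exact (QuantumMetric.Passage.compact_of_specDiam_le h₁ h₂ hτ hd).2
  · exact (QuantumMetric.Passage.compact_of_specDiam_le h₂ h₁ hτ.symm hd).2
  · exact QuantumMetric.tfae_isTunnel hA.leibniz.1 hB.leibniz.1 τ
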